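/- Fix a field $\mathbb F$ of coefficients. **Towers of covers.** A tower of covers $\mathfrak W$ of a space $Z$ with resolution $r=\mathrm{res}(\mathfrak W)\in\mathbb R$ consists of a finite indexed cover $\mathcal W_\varepsilon=\{W_{\varepsilon,\alpha}\}_{\alpha\in A_\varepsilon}$ of $Z$ for every real $\varepsilon\ge r$ and maps of covers $w_{\varepsilon,\varepsilon'}:\mathcal W_\varepsilon\to\mathcal W_{\varepsilon'}$ for $r\le\varepsilon\le\varepsilon'$ with $w_{\varepsilon,\varepsilon}=\mathrm{id}$ and $w_{\varepsilon',\varepsilon''}\circ w_{\varepsilon,\varepsilon'}=w_{\varepsilon,\varepsilon''}$; a map of covers is a map of index sets sending each cover element to an element that contains it. Two towers $\mathfrak U,\mathfrak V$ of covers of $Z$ with the same resolution $r$ are $\eta$-interleaved ($\eta\ge 0$) if for all $\varepsilon\ge r$ there are maps of covers $\mathcal U_\varepsilon\to\mathcal V_{\varepsilon+\eta}$ and $\mathcal V_\varepsilon\to\mathcal U_{\varepsilon+\eta}$. If $r>0$, then $\mathrm R_{\log}(\mathfrak W)$ is the tower with resolution $\log r$ whose cover at $\varepsilon\ge\log r$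 is $\mathcal W_{\exp\varepsilon}$, with the corresponding maps. For $c\ge 1$ and $s>0$, a tower of covers $\mathfrak W$ of a compact metric space $(Z,d_Z)$ is $(c,s)$-good if (1) $\mathrm{res}(\mathfrak W)=s\le\mathrm{diam}(Z)$; (2) $\mathrm{diam}(W)\le\varepsilon$ for all $\varepsilon\ge s$ and $W\in\mathcal W_\varepsilon$; (3) every $O\subseteq Z$ with $\mathrm{diam}(O)\ge s$ is contained in some $W\in\mathcal W_{c\cdot\mathrm{diam}(O)}$. **Multiscale mapper.** A map $f:X\to Z$ of topological spaces is well-behaved if $f^{-1}(O)$ has finitely many path components for every path connected open set $O\subseteq Z$. The pullback tower $f^*(\mathfrak W)$ has at $\varepsilon$ the cover of $X$ by the path components of the sets $f^{-1}(W_{\varepsilon,\alpha})$, $\alpha\in A_\varepsilon$, with the induced maps of covers. The multiscale mapper $\mathrm{MM}(\mathfrak W,f)$ is the tower of the nerves of the covers of $f^*(\mathfrak W)$ with the induced simplicial maps. For $k\ge 0$, $\mathrm D_k\mathrm{MM}(\mathfrak W,f)$ denotes the persistence diagram of the persistence module formed by the simplicial homology spaces $H_k(\,\cdot\,;\mathbb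 F)$ of these nerves: the multiset of points $(b,d)$, $b<d\le\infty$, that records births and deaths with multiplicity. The bottleneck distance of two diagrams is the infimum, over all partial matchings of their points, of the largest $\ell^\infty$-distance between matched points or from an unmatched point $(b,d)$ to the diagonal (which is $(d-b)/2$). **Theorem.** Let $(Z,d_Z)$ be a compact path connected metric space, let $c\ge1$, $s>0$, $\eta\ge0$, and let $\mathfrak U,\mathfrak V$ be $\eta$-interleaved $(c,s)$-good towers of covers of $Z$ whose covers consist of path connected open sets. Let $X$ be a topological space and let $f,g:X\to Z$ be well-behaved continuous maps with $d_Z(f(x),g(x))\le\delta$ for all $x\in X$. Then for every $k\in\mathbb N$ the $k$-th homology spaces of all nerves in $\mathrm{MM}(\mathrm R_{\log}(\mathfrak U),f)$ and $\mathrm{MM}(\mathrm R_{\log}(\mathfrak V),g)$ are finite dimensional (so that their persistence diagrams are defined), and the bottleneck distance between $\mathrm D_k\mathrm{MM}(\mathrm R_{\log}(\mathfrak U),f)$ and $\mathrm D_k\mathrm{MM}(\mathrm R_{\log}(\mathfrak V),g)$ is at most $$\log\bigl(2c\max(s,\delta)+c+\eta\bigr)+\max\Bigl(0,\log\frac1s\Bigr).$$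 -/

import Mathlib

open scoped ENNReal

noncomputable section

namespace MultiscaleMapper

universe u v w

/-! ### Simplicial complexes, simplicial maps and simplicial homology -/

/-- A simplicial map between abstract simplicial complexes: a map of vertices that sends
simplices to simplices. -/
@[ext]
structure SimplicialMap {V : Type u} {W : Type v} (K : PreAbstractSimplicialComplex V)
    (L : PreAbstractSimplicialComplex W) where
  toFun : V → W
  image_mem : ∀ σ ∈ K.faces, (σ.finite_toSet.image toFun).toFinset ∈ L.faces

/-- The identity simplicial map. -/
def SimplicialMap.id {V : Type u} (K : PreAbstractSimplicialComplex V) : SimplicialMap K K where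
  toFun := fun x => x
  image_mem σ hσ := by simpa using hσ

/-- Composition of simplicial maps. -/
def SimplicialMap.comp {V₁ : Type u} {V₂ : Type v} {V₃ : Type w}
    {K : PreAbstractSimplicialComplex V₁} {L : PreAbstractSimplicialComplex V₂}
    {M : PreAbstractSimplicialComplex V₃} (ψ : SimplicialMap L M) (φ : SimplicialMap K L) :
    SimplicialMap K M where
  toFun := ψ.toFun ∘ φ.toFun
  image_mem σ hσ := by
    have h := ψ.image_mem _ (φ.image_mem σ hσ)
    convert h using 1
    ext x
    simp

/-- Ordered `n`-simplices of a complex: tuples `(v₀, …, vₙ)` of vertices, repetitions allowed,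
whose set of entries is a simplex. -/
def OrderedSimplex {V : Type u} (K : PreAbstractSimplicialComplex V) (n : ℕ) : Type u :=
  {v : Fin (n + 1) → V // (Set.finite_range v).toFinset ∈ K.faces}

/-- The `i`-th face `(v₀, …, v̂ᵢ, …, vₙ₊₁)` of an ordered simplex. -/
def OrderedSimplex.face {V : Type u} {K : PreAbstractSimplicialComplex V} {n : ℕ}
    (i : Fin (n + 2)) (v : OrderedSimplex K (n + 1)) : OrderedSimplex K n :=
  ⟨v.1 ∘ i.succAbove, (K.isRelLowerSet_faces v.2).2
    (by
      intro x hx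
      simp only [Set.Finite.mem_toFinset, Set.mem_range, Function.comp_apply] at hx ⊢
      obtain ⟨j, hj⟩ := hx
      exact ⟨_, hj⟩)
    ⟨v.1 (i.succAbove 0), by simp⟩⟩

/-- The image of an ordered simplex under a simplicial map. -/
def OrderedSimplex.map {V : Type u} {W : Type v} {K : PreAbstractSimplicialComplex V}
    {L : PreAbstractSimplicialComplex W} (φ : SimplicialMap K L) {n : ℕ}
    (v : OrderedSimplex K n) : OrderedSimplex L n :=
  ⟨φ.toFun ∘ v.1, by
    have h := φ.image_mem _ v.2
    convert h using 1
    ext x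
    simp⟩

/-- The space of ordered simplicial `n`-chains with coefficients in `𝕜`. -/
def Chains (𝕜 : Type w) [Field 𝕜] {V : Type u} (K : PreAbstractSimplicialComplex V) (n : ℕ) :
    Type (max u w) :=
  OrderedSimplex K n →₀ 𝕜

instance (𝕜 : Type w) [Field 𝕜] {V : Type u} (K : PreAbstractSimplicialComplex V) (n : ℕ) :
    AddCommGroup (Chains 𝕜 K n) :=
  inferInstanceAs (AddCommGroup (OrderedSimplex K n →₀ 𝕜))

instance (𝕜 : Type w) [Field 𝕜] {V : Type u} (K : PreAbstractSimplicialComplex V) (n : ℕ) :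
    Module 𝕜 (Chains 𝕜 K n) :=
  inferInstanceAs (Module 𝕜 (OrderedSimplex K n →₀ 𝕜))

/-- The linear map on chains given by a map of ordered simplices. -/
def chainsMapDomain (𝕜 : Type w) [Field 𝕜] {V : Type u} {W : Type v}
    {K : PreAbstractSimplicialComplex V} {L : PreAbstractSimplicialComplex W} {m n : ℕ}
    (F : OrderedSimplex K m → OrderedSimplex L n) : Chains 𝕜 K m →ₗ[𝕜] Chains 𝕜 L n :=
  (Finsupp.lmapDomain 𝕜 𝕜 F : (OrderedSimplex K m →₀ 𝕜) →ₗ[𝕜] (OrderedSimplex L n →₀ 𝕜))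

theorem chainsMapDomain_comp (𝕜 : Type*) [Field 𝕜] {V₁ V₂ V₃ : Type*}
    {K : PreAbstractSimplicialComplex V₁} {L : PreAbstractSimplicialComplex V₂}
    {M : PreAbstractSimplicialComplex V₃} {l m n : ℕ} (G : OrderedSimplex L m → OrderedSimplex M n)
    (F : OrderedSimplex K l → OrderedSimplex L m) (x : Chains 𝕜 K l) :
    chainsMapDomain 𝕜 (G ∘ F) x = chainsMapDomain 𝕜 G (chainsMapDomain 𝕜 F x) :=
  Finsupp.mapDomain_comp (v := (x : OrderedSimplex K l →₀ 𝕜))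

/-- The boundary operator `∂ (v₀, …, vₙ₊₁) = ∑ᵢ (-1)ⁱ (v₀, …, v̂ᵢ, …, vₙ₊₁)`. -/
def boundary (𝕜 : Type w) [Field 𝕜] {V : Type u} (K : PreAbstractSimplicialComplex V) (n : ℕ) :
    Chains 𝕜 K (n + 1) →ₗ[𝕜] Chains 𝕜 K n :=
  ∑ i : Fin (n + 2), (-1 : 𝕜) ^ (i : ℕ) • chainsMapDomain 𝕜 (OrderedSimplex.face i)

/-- The space of `k`-cycles; every `0`-chain is a cycle (homology is not reduced). -/
def cycles (𝕜 : Type w) [Field 𝕜] {V : Type u} (K : PreAbstractSimplicialComplex V) :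
    (k : ℕ) → Submodule 𝕜 (Chains 𝕜 K k)
  | 0 => ⊤
  | k + 1 => LinearMap.ker (boundary 𝕜 K k)

/-- The `k`-boundaries, as a subspace of the `k`-cycles. -/
def boundaries (𝕜 : Type w) [Field 𝕜] {V : Type u} (K : PreAbstractSimplicialComplex V) (k : ℕ) :
    Submodule 𝕜 (cycles 𝕜 K k) :=
  (LinearMap.range (boundary 𝕜 K k)).comap (cycles 𝕜 K k).subtype

/-- Simplicial homology in degree `k` with coefficients in `𝕜`, computed by the complex of
ordered simplicial chains. -/
abbrev Homology (𝕜 : Type w) [Field 𝕜] {V : Type u} (K : PreAbstractSimplicialComplex V) (k : ℕ) :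
    Type (max u w) :=
  cycles 𝕜 K k ⧸ boundaries 𝕜 K k

/-- The map on chains induced by a simplicial map. -/
def chainMap (𝕜 : Type w) [Field 𝕜] {V : Type u} {W : Type v}
    {K : PreAbstractSimplicialComplex V} {L : PreAbstractSimplicialComplex W}
    (φ : SimplicialMap K L) (n : ℕ) : Chains 𝕜 K n →ₗ[𝕜] Chains 𝕜 L n :=
  chainsMapDomain 𝕜 (OrderedSimplex.map φ)

theorem boundary_chainMap (𝕜 : Type w) [Field 𝕜] {V : Type u} {W : Type v}
    {K : PreAbstractSimplicialComplex V} {L : PreAbstractSimplicialComplex W}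
    (φ : SimplicialMap K L) (n : ℕ) (x : Chains 𝕜 K (n + 1)) :
    boundary 𝕜 L n (chainMap 𝕜 φ (n + 1) x) = chainMap 𝕜 φ n (boundary 𝕜 K n x) := by
  simp only [boundary, chainMap, LinearMap.sum_apply, LinearMap.smul_apply, map_sum, map_smul,
    ← chainsMapDomain_comp]
  rfl

theorem chainMap_mem_cycles (𝕜 : Type w) [Field 𝕜] {V : Type u} {W : Type v}
    {K : PreAbstractSimplicialComplex V} {L : PreAbstractSimplicialComplex W}
    (φ : SimplicialMap K L) (k : ℕ) (x : Chains 𝕜 K k) (hx : x ∈ cycles 𝕜 K k) :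
    chainMap 𝕜 φ k x ∈ cycles 𝕜 L k := by
  cases k with
  | zero => exact Submodule.mem_top
  | succ k =>
    have hx' : boundary 𝕜 K k x = 0 := hx
    change boundary 𝕜 L k _ = 0
    rw [boundary_chainMap, hx', map_zero]

/-- The map on cycles induced by a simplicial map. -/
def cyclesMap (𝕜 : Type w) [Field 𝕜] {V : Type u} {W : Type v}
    {K : PreAbstractSimplicialComplex V} {L : PreAbstractSimplicialComplex W}
    (φ : SimplicialMap K L) (k : ℕ) : cycles 𝕜 K k →ₗ[𝕜] cycles 𝕜 L k :=
  (chainMap 𝕜 φ k).restrict (chainMap_mem_cycles 𝕜 φ k)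

/-- The map on homology induced by a simplicial map. -/
def homologyMap (𝕜 : Type w) [Field 𝕜] {V : Type u} {W : Type v}
    {K : PreAbstractSimplicialComplex V} {L : PreAbstractSimplicialComplex W}
    (φ : SimplicialMap K L) (k : ℕ) : Homology 𝕜 K k →ₗ[𝕜] Homology 𝕜 L k :=
  Submodule.mapQ _ _ (cyclesMap 𝕜 φ k) (by
    rintro ⟨x, hx⟩ ⟨y, hy⟩
    refine ⟨chainMap 𝕜 φ (k + 1) y, ?_⟩
    rw [boundary_chainMap, hy]
    rfl)

theorem homologyMap_id (𝕜 : Type w) [Field 𝕜] {V : Type u} (K : PreAbstractSimplicialComplex V)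
    (k : ℕ) (x : Homology 𝕜 K k) : homologyMap 𝕜 (SimplicialMap.id K) k x = x := by
  obtain ⟨x, rfl⟩ := Submodule.Quotient.mk_surjective _ x
  have h : cyclesMap 𝕜 (SimplicialMap.id K) k x = x :=
    Subtype.ext (Finsupp.mapDomain_id (v := x.1))
  change Submodule.Quotient.mk (cyclesMap 𝕜 (SimplicialMap.id K) k x) = _
  rw [h]

theorem homologyMap_comp (𝕜 : Type*) [Field 𝕜] {V₁ V₂ V₃ : Type*}
    {K : PreAbstractSimplicialComplex V₁} {L : PreAbstractSimplicialComplex V₂}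
    {M : PreAbstractSimplicialComplex V₃} (ψ : SimplicialMap L M) (φ : SimplicialMap K L)
    (k : ℕ) (x : Homology 𝕜 K k) :
    homologyMap 𝕜 (ψ.comp φ) k x = homologyMap 𝕜 ψ k (homologyMap 𝕜 φ k x) := by
  obtain ⟨x, rfl⟩ := Submodule.Quotient.mk_surjective _ x
  have h : cyclesMap 𝕜 (ψ.comp φ) k x = cyclesMap 𝕜 ψ k (cyclesMap 𝕜 φ k x) :=
    Subtype.ext (chainsMapDomain_comp 𝕜 (OrderedSimplex.map ψ) (OrderedSimplex.map φ) x.1)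
  change Submodule.Quotient.mk (cyclesMap 𝕜 (ψ.comp φ) k x) = _
  rw [h]
  rfl

/-! ### Towers -/

/-- A tower of covers of `X`, with resolution `res`: for every `ε ≥ res` an indexed cover
`(elem ε α)_α` of `X`, and for `res ≤ ε ≤ ε'` compatible maps of covers. A map of covers is a map
of index sets that sends each element to an element containing it. Data at parameters below
`res` are never used. Finiteness of the covers is the separate predicate `IsFinite`. -/
structure CoverTower (X : Type u) where
  res : ℝ
  Idx : ℝ → Type v
  elem : (ε : ℝ) → Idx ε → Set X
  iUnion_elem : ∀ ε, res ≤ ε → ⋃ α, elem ε α = Set.univ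
  map : (ε ε' : ℝ) → res ≤ ε → ε ≤ ε' → Idx ε → Idx ε'
  elem_subset : ∀ ε ε' (h : res ≤ ε) (h' : ε ≤ ε') (α : Idx ε),
    elem ε α ⊆ elem ε' (map ε ε' h h' α)
  map_id : ∀ ε (h : res ≤ ε) (α : Idx ε), map ε ε h le_rfl α = α
  map_comp : ∀ ε ε' ε'' (h : res ≤ ε) (h' : ε ≤ ε') (h'' : ε' ≤ ε'') (α : Idx ε),
    map ε' ε'' (h.trans h') h'' (map ε ε' h h' α) = map ε ε'' h (h'.trans h'') α

/-- All covers of the tower are finite. -/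
def CoverTower.IsFinite {X : Type u} (W : CoverTower.{u, v} X) : Prop :=
  ∀ ε, W.res ≤ ε → Finite (W.Idx ε)

/-- All covers of the tower consist of path connected open sets. -/
def CoverTower.IsOpenPathConnected {X : Type u} [TopologicalSpace X] (W : CoverTower.{u, v} X) : Prop :=
  ∀ ε, W.res ≤ ε → ∀ α, IsOpen (W.elem ε α) ∧ IsPathConnected (W.elem ε α)

/-- The tower reindexed by the logarithm: its cover at `ε ≥ log res` is the original cover at
`exp ε`. -/
def CoverTower.reindexLog {X : Type u} (W : CoverTower.{u, v} X) : CoverTower.{u, v} X :=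
  have key : ∀ ε, Real.log W.res ≤ ε → W.res ≤ Real.exp ε := fun ε h => by
    rcases le_or_gt W.res 0 with h0 | h0
    · exact h0.trans (Real.exp_pos ε).le
    · exact (Real.log_le_iff_le_exp h0).1 h
  { res := Real.log W.res
    Idx := fun ε => W.Idx (Real.exp ε)
    elem := fun ε => W.elem (Real.exp ε)
    iUnion_elem := fun ε h => W.iUnion_elem _ (key ε h)
    map := fun ε ε' h h' => W.map _ _ (key ε h) (Real.exp_le_exp.2 h')
    elem_subset := fun ε ε' h h' => W.elem_subset _ _ (key ε h) (Real.exp_le_exp.2 h')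
    map_id := fun ε h => W.map_id _ (key ε h)
    map_comp := fun ε ε' ε'' h h' h'' =>
      W.map_comp _ _ _ (key ε h) (Real.exp_le_exp.2 h') (Real.exp_le_exp.2 h'') }

/-- The map between sets of path components induced by an inclusion of subsets. -/
def pathComponentsMap {X : Type u} [TopologicalSpace X] {A B : Set X} (h : A ⊆ B) :
    ZerothHomotopy A → ZerothHomotopy B :=
  Quotient.map (Set.inclusion h) fun _ _ hxy => hxy.map (continuous_inclusion h)

/-- The path component of `A`, seen as a subset of `X`. -/
def pathComponentSet {X : Type u} [TopologicalSpace X] {A : Set X} (C : ZerothHomotopy A) :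
    Set X :=
  {x | ∃ h : x ∈ A, ZerothHomotopy.mk (⟨x, h⟩ : A) = C}

/-- The pullback of a tower of covers along `f`: the cover at `ε` consists of the path components
of the preimages `f ⁻¹' (W.elem ε α)`, indexed by pairs of an index `α` and a path component. -/
def CoverTower.pullback {X : Type u} {Z : Type w} [TopologicalSpace X] (f : X → Z)
    (W : CoverTower.{w, v} Z) : CoverTower.{u, max u v} X where
  res := W.res
  Idx ε := Σ α : W.Idx ε, ZerothHomotopy (f ⁻¹' W.elem ε α)
  elem ε p := pathComponentSet p.2
  iUnion_elem ε h := by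
    refine Set.eq_univ_of_forall fun x => ?_
    have hx : f x ∈ ⋃ α, W.elem ε α := by rw [W.iUnion_elem ε h]; trivial
    obtain ⟨α, hα⟩ := Set.mem_iUnion.1 hx
    exact Set.mem_iUnion.2 ⟨⟨α, ZerothHomotopy.mk ⟨x, hα⟩⟩, hα, rfl⟩
  map ε ε' h h' p :=
    ⟨W.map ε ε' h h' p.1, pathComponentsMap (Set.preimage_mono (W.elem_subset ε ε' h h' p.1)) p.2⟩
  elem_subset ε ε' h h' p := by
    rintro x ⟨hx, hp⟩
    refine ⟨W.elem_subset ε ε' h h' p.1 hx, ?_⟩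
    rw [← hp]
    rfl
  map_id ε h := by
    rintro ⟨α, C⟩
    obtain ⟨⟨x, hx⟩, rfl⟩ := Quotient.exists_rep C
    have hα := W.map_id ε h α
    have key : ∀ (β : W.Idx ε) (hβ : f ⁻¹' W.elem ε α ⊆ f ⁻¹' W.elem ε β), β = α →
        (⟨β, pathComponentsMap hβ (Quotient.mk _ ⟨x, hx⟩)⟩ :
          Σ α : W.Idx ε, ZerothHomotopy (f ⁻¹' W.elem ε α)) = ⟨α, Quotient.mk _ ⟨x, hx⟩⟩ := by
      rintro β hβ rfl
      rfl
    exact key _ _ hα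
  map_comp ε ε' ε'' h h' h'' := by
    rintro ⟨α, C⟩
    obtain ⟨⟨x, hx⟩, rfl⟩ := Quotient.exists_rep C
    have key : ∀ (β γ : W.Idx ε'') (hβ : f x ∈ W.elem ε'' β) (hγ : f x ∈ W.elem ε'' γ), β = γ →
        (⟨β, Quotient.mk _ ⟨x, hβ⟩⟩ : Σ α : W.Idx ε'', ZerothHomotopy (f ⁻¹' W.elem ε'' α)) =
          ⟨γ, Quotient.mk _ ⟨x, hγ⟩⟩ := by
      rintro β γ hβ hγ rfl
      rfl
    exact key _ _ _ _ (W.map_comp ε ε' ε'' h h' h'' α)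

/-- The nerve of an indexed family of sets: its simplices are the finite non-empty sets of
indices whose sets have a common point. -/
def nerve {X : Type u} {A : Type v} (U : A → Set X) : PreAbstractSimplicialComplex A where
  faces := {σ | σ.Nonempty ∧ (⋂ α ∈ σ, U α).Nonempty}
  isRelLowerSet_faces := by
    rintro σ ⟨h1, x, hx⟩
    refine ⟨h1, fun τ hτ hne => ⟨hne, x, ?_⟩⟩
    simp only [Set.mem_iInter] at hx ⊢
    exact fun α hα => hx α (hτ hα)

/-- The simplicial map of nerves induced by a map of covers. -/
def nerveMap {X : Type u} {A : Type v} {B : Type w} {U : A → Set X} {U' : B → Set X} (ξ : A → B)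
    (hξ : ∀ α, U α ⊆ U' (ξ α)) : SimplicialMap (nerve U) (nerve U') where
  toFun := ξ
  image_mem := by
    rintro σ ⟨⟨α, hα⟩, x, hx⟩
    refine ⟨⟨ξ α, by simpa using ⟨α, hα, rfl⟩⟩, x, ?_⟩
    simp only [Set.mem_iInter, Set.Finite.mem_toFinset] at hx ⊢
    rintro _ ⟨β, hβ, rfl⟩
    exact hξ β (hx β hβ)

/-- A tower of simplicial complexes with resolution `res`. -/
structure SimplicialTower where
  res : ℝ
  Vert : ℝ → Type v
  cplx : (ε : ℝ) → PreAbstractSimplicialComplex (Vert ε)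
  map : (ε ε' : ℝ) → res ≤ ε → ε ≤ ε' → SimplicialMap (cplx ε) (cplx ε')
  map_id : ∀ ε (h : res ≤ ε), map ε ε h le_rfl = SimplicialMap.id (cplx ε)
  map_comp : ∀ ε ε' ε'' (h : res ≤ ε) (h' : ε ≤ ε') (h'' : ε' ≤ ε''),
    (map ε' ε'' (h.trans h') h'').comp (map ε ε' h h') = map ε ε'' h (h'.trans h'')

/-- The tower of nerves of a tower of covers. -/
def CoverTower.nerveTower {X : Type u} (W : CoverTower.{u, v} X) : SimplicialTower.{v} where
  res := W.res
  Vert := W.Idx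
  cplx ε := nerve (W.elem ε)
  map ε ε' h h' := nerveMap (W.map ε ε' h h') (W.elem_subset ε ε' h h')
  map_id ε h := SimplicialMap.ext (funext (W.map_id ε h))
  map_comp ε ε' ε'' h h' h'' := SimplicialMap.ext (funext (W.map_comp ε ε' ε'' h h' h''))

/-- The multiscale mapper: the tower of nerves of the pullback tower. -/
def MM {X : Type u} {Z : Type w} [TopologicalSpace X] (W : CoverTower.{w, v} Z) (f : X → Z) :
    SimplicialTower.{max u v} :=
  (W.pullback f).nerveTower

/-! ### Persistence modules, persistence diagrams and the bottleneck distance -/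

/-- A persistence module with resolution `res`: a tower of vector spaces and linear maps,
indexed by `ε ≥ res`. -/
structure PersistenceModule (𝕜 : Type w) [Field 𝕜] where
  res : ℝ
  space : ℝ → Type v
  [addCommGroup : ∀ ε, AddCommGroup (space ε)]
  [module : ∀ ε, Module 𝕜 (space ε)]
  map : (ε ε' : ℝ) → res ≤ ε → ε ≤ ε' → space ε →ₗ[𝕜] space ε'
  map_id : ∀ ε (h : res ≤ ε) (x : space ε), map ε ε h le_rfl x = x
  map_comp : ∀ ε ε' ε'' (h : res ≤ ε) (h' : ε ≤ ε') (h'' : ε' ≤ ε'') (x : space ε),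
    map ε' ε'' (h.trans h') h'' (map ε ε' h h' x) = map ε ε'' h (h'.trans h'') x

attribute [instance] PersistenceModule.addCommGroup PersistenceModule.module

/-- The `k`-th homology of a tower of simplicial complexes, with coefficients in `𝕜`. -/
def SimplicialTower.homology (𝕜 : Type w) [Field 𝕜] (S : SimplicialTower.{v}) (k : ℕ) :
    PersistenceModule.{max v w} 𝕜 where
  res := S.res
  space ε := Homology 𝕜 (S.cplx ε) k
  map ε ε' h h' := homologyMap 𝕜 (S.map ε ε' h h') k
  map_id ε h x := by rw [S.map_id, homologyMap_id]
  map_comp ε ε' ε'' h h' h'' x := by rw [← homologyMap_comp, S.map_comp]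

/-- All spaces of the persistence module are finite dimensional. -/
def PersistenceModule.IsPointwiseFinite {𝕜 : Type w} [Field 𝕜]
    (M : PersistenceModule.{v} 𝕜) : Prop :=
  ∀ ε, M.res ≤ ε → FiniteDimensional 𝕜 (M.space ε)

/-- The rank function `(a, b) ↦ rank (M_a → M_b)`; the module is extended by zero below its
resolution. -/
def PersistenceModule.rank {𝕜 : Type w} [Field 𝕜] (M : PersistenceModule.{v} 𝕜) (a b : ℝ) : ℕ :=
  open Classical in
  if h : M.res ≤ a ∧ a ≤ b then Module.finrank 𝕜 (LinearMap.range (M.map a b h.1 h.2)) else 0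

/-- The multiplicity of the point `(b, d)`, where `b < d ≤ ∞`, in the persistence diagram of a
module with rank function `r`. For finite `d` it is the least value, over rectangles
`[p, q] × [t, t']` around `(b, d)` above the diagonal, of the number
`r q t - r p t - r q t' + r p t'` of intervals of the module which are born in `[p, q]` and die in
`[t, t']`. For `d = ∞` one takes the rectangles `[p, q] × [t, ∞]`. -/
def multiplicity (r : ℝ → ℝ → ℕ) (b : ℝ) : WithTop ℝ → ℕ
  | none => sInf {n | ∃ p q t : ℝ, p < b ∧ b < q ∧ q < t ∧ n = r q t - r p t}
  | some d => sInf {n | ∃ p q t t' : ℝ, p < b ∧ b < q ∧ q < t ∧ t < d ∧ d < t' ∧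
      n = (r q t + r p t') - (r p t + r q t')}

/-- A persistence diagram: a multiset of points `(b, d)` with `b < d ≤ ∞` (birth and death), given
by the multiplicities of its points. Points of the diagonal are not recorded. -/
abbrev Diagram : Type := {p : ℝ × WithTop ℝ // (p.1 : WithTop ℝ) < p.2} → ℕ

/-- The persistence diagram of a (pointwise finite dimensional) persistence module. -/
def PersistenceModule.diagram {𝕜 : Type w} [Field 𝕜] (M : PersistenceModule.{v} 𝕜) : Diagram :=
  fun p => multiplicity M.rank p.1.1 p.1.2

/-- The `k`-th persistence diagram of a tower of simplicial complexes. -/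
def SimplicialTower.diagram (𝕜 : Type w) [Field 𝕜] (S : SimplicialTower.{v}) (k : ℕ) : Diagram :=
  (S.homology 𝕜 k).diagram

/-- The points of a diagram, each repeated according to its multiplicity. -/
def Diagram.Points (D : Diagram) : Type :=
  Σ p : {p : ℝ × WithTop ℝ // (p.1 : WithTop ℝ) < p.2}, Fin (D p)

/-- The distance `|d - d'|` of two death times; `∞` is at distance `0` from itself and at infinite
distance from every real number. -/
def deathDist : WithTop ℝ → WithTop ℝ → ℝ≥0∞
  | none, none => 0
  | some d, some d' => edist d d'
  | none, some _ => ⊤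
  | some _, none => ⊤

/-- The `ℓ^∞` distance of two points of the extended plane. -/
def pointDist (p p' : ℝ × WithTop ℝ) : ℝ≥0∞ :=
  max (edist p.1 p'.1) (deathDist p.2 p'.2)

/-- The `ℓ^∞` distance of a point `(b, d)` to the diagonal: `(d - b) / 2`. -/
def diagonalDist : ℝ × WithTop ℝ → ℝ≥0∞
  | (_, none) => ⊤
  | (b, some d) => ENNReal.ofReal ((d - b) / 2)

/-- The cost of a partial matching of two diagrams, in which the unmatched points are matched to
the diagonal. -/
def matchingCost {D E : Diagram} (m : D.Points ≃. E.Points) : ℝ≥0∞ :=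
  max (⨆ (x : D.Points) (y : E.Points) (_ : y ∈ m x), pointDist x.1.1 y.1.1)
    (max (⨆ (x : D.Points) (_ : m x = none), diagonalDist x.1.1)
      (⨆ (y : E.Points) (_ : m.symm y = none), diagonalDist y.1.1))

/-- The bottleneck distance of two persistence diagrams. -/
def bottleneckDist (D E : Diagram) : ℝ≥0∞ :=
  ⨅ m : D.Points ≃. E.Points, matchingCost m

/-! ### Interleavings, good towers and well-behaved maps -/

/-- Two towers of covers with the same resolution are `η`-interleaved if there are maps of covers
`U_ε → V_{ε+η}` and `V_ε → U_{ε+η}` for all `ε` from the resolution on. -/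
def Interleaved {X : Type u} (η : ℝ) (U : CoverTower.{u, v} X) (V : CoverTower.{u, w} X) : Prop :=
  0 ≤ η ∧ U.res = V.res ∧
    (∀ ε, U.res ≤ ε →
      ∃ ζ : U.Idx ε → V.Idx (ε + η), ∀ α, U.elem ε α ⊆ V.elem (ε + η) (ζ α)) ∧
    (∀ ε, V.res ≤ ε →
      ∃ ξ : V.Idx ε → U.Idx (ε + η), ∀ α, V.elem ε α ⊆ U.elem (ε + η) (ξ α))

/-- `(c, s)`-good towers of covers of a compact metric space. -/
structure IsGood {Z : Type u} [MetricSpace Z] [CompactSpace Z] (c s : ℝ)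
    (W : CoverTower.{u, v} Z) : Prop where
  one_le : 1 ≤ c
  pos : 0 < s
  finite : W.IsFinite
  res_eq : W.res = s
  le_diam : s ≤ Metric.diam (Set.univ : Set Z)
  diam_le : ∀ ε, s ≤ ε → ∀ α, Metric.diam (W.elem ε α) ≤ ε
  exists_superset : ∀ O : Set Z, s ≤ Metric.diam O → ∃ α, O ⊆ W.elem (c * Metric.diam O) α

/-- A map is well-behaved if the preimage of every path connected open set has only finitely many
path components. -/
def WellBehaved {X : Type u} {Z : Type w} [TopologicalSpace X] [TopologicalSpace Z]
    (f : X → Z) : Prop :=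
  ∀ O : Set Z, IsOpen O → IsPathConnected O → Finite (ZerothHomotopy (f ⁻¹' O))

end MultiscaleMapper

end

open scoped ENNReal

noncomputable section

namespace MultiscaleMapper

universe u v v' w v₁ v₂ t

/-! The towers are compared by thickening cover elements. Put `ρ = max s δ` and let `W` be an
element of one tower at scale `exp a`. Its closed `ρ`-thickening has diameter at most `exp a + 2ρ`,
and at least `s` because `Z` is path connected (`le_diam_cthickening`). Goodness therefore places it
inside an element of the other tower at scale `exp b` as soon as `c (exp a + 2ρ) ≤ exp b`. Since `f`
and `g` differ by at most `ρ`, the preimage of `W` under one map lies in the preimage of that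
element under the other (`IsGood.exists_preimage_subset`). On the logarithmic scale the condition
holds once `b - a` is at least the bound of the theorem (`mul_exp_add_le_exp`). This gives maps of
the pullback covers in both directions. Any two maps between the same covers are contiguous on
nerves, hence equal on homology (`Contiguous.homologyMap_eq`), so all required diagrams commute and
the two persistence modules `M`, `N` are `ε`-interleaved, with `ε` the bound of the theorem.

What remains is algebraic stability, proved from rank functions alone, without decomposing modules
into intervals. All but countably many real values are regular, and a box with regular sides
contains exactly as many diagram points as the rank function predicts (`Represents.countsBox`).
Consider the image of the interleaving morphism, with rank function `(a, b) ↦ rank (M_a → N_{b+ε})`,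
and call its diagram `Q`. One fact of linear algebra (`finrank_map_add_le`) compares the point
counts of `M`, `Q` and `N` on a regular grid of mesh `h` dividing `ε`. Within each birth cell,
pairing points in order of death embeds the points of `Q` that are not too short into those of `M`;
within each death cell, pairing in order of birth embeds them into those of `N`, shifted by `ε`. The
composite through `Q` moves coordinates by at most `ε + h` and leaves unmatched only points within
`ε + h` of the diagonal (`exists_induced_matching`, `exists_matching_of_rank`). Then `h` tends to
zero.

Infinite deaths are handled by truncation. From `log (c * diam Z)` on, some cover element contains
all of `Z`, so the modules are constant up to isomorphism. Setting them to zero from a far `T'` on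
turns every infinite death into `T'`. -/

/-! ### Contiguous simplicial maps -/

/-! ### The prism homotopy on formal combinations of tuples -/

section Tuples

variable (𝕜 : Type*) [Field 𝕜] {V W : Type*}

/-- Linear extension of prepending a vertex to a tuple. -/
def tupleCons (w : V) (n : ℕ) : ((Fin n → V) →₀ 𝕜) →ₗ[𝕜] ((Fin (n + 1) → V) →₀ 𝕜) :=
  Finsupp.lmapDomain 𝕜 𝕜 (fun v => (Fin.cons w v : Fin (n + 1) → V))

/-- Linear extension of a map of vertices to tuples. -/
def tupleMap (φ : V → W) (n : ℕ) : ((Fin n → V) →₀ 𝕜) →ₗ[𝕜] ((Fin n → W) →₀ 𝕜) :=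
  Finsupp.lmapDomain 𝕜 𝕜 (fun v => φ ∘ v)

/-- The augmented boundary operator on tuples. -/
def tupleBoundary (V : Type*) (n : ℕ) : ((Fin (n + 1) → V) →₀ 𝕜) →ₗ[𝕜] ((Fin n → V) →₀ 𝕜) :=
  ∑ i : Fin (n + 1), (-1 : 𝕜) ^ (i : ℕ) • Finsupp.lmapDomain 𝕜 𝕜 (fun v => v ∘ i.succAbove)

/-- The prism operator between the tuple maps given by `φ` and `ψ`. -/
def tuplePrism (φ ψ : V → W) : (n : ℕ) → ((Fin n → V) →₀ 𝕜) →ₗ[𝕜] ((Fin (n + 1) → W) →₀ 𝕜)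
  | 0 => 0
  | n + 1 => Finsupp.lsum 𝕜 fun v => LinearMap.toSpanSingleton 𝕜 _
      (tupleCons 𝕜 (φ (v 0)) (n + 1) (Finsupp.single (ψ ∘ v) 1) -
        tupleCons 𝕜 (φ (v 0)) (n + 1) (tuplePrism φ ψ n (Finsupp.single (Fin.tail v) 1)))

variable {𝕜}

@[simp]
theorem tupleCons_single (w : V) (n : ℕ) (v : Fin n → V) (a : 𝕜) :
    tupleCons 𝕜 w n (Finsupp.single v a) = Finsupp.single (Fin.cons w v) a := by
  simp [tupleCons]

@[simp]
theorem tupleMap_single (φ : V → W) (n : ℕ) (v : Fin n → V) (a : 𝕜) :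
    tupleMap 𝕜 φ n (Finsupp.single v a) = Finsupp.single (φ ∘ v) a := by
  simp [tupleMap]

theorem tuplePrism_single (φ ψ : V → W) (n : ℕ) (v : Fin (n + 1) → V) :
    tuplePrism 𝕜 φ ψ (n + 1) (Finsupp.single v 1) =
      Finsupp.single (Fin.cons (φ (v 0)) (ψ ∘ v)) 1 -
        tupleCons 𝕜 (φ (v 0)) (n + 1) (tuplePrism 𝕜 φ ψ n (Finsupp.single (Fin.tail v) 1)) := by
  simp [tuplePrism]

theorem tuplePrism_cons (φ ψ : V → W) (n : ℕ) (w : V) (x : (Fin n → V) →₀ 𝕜) :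
    tuplePrism 𝕜 φ ψ (n + 1) (tupleCons 𝕜 w n x) =
      tupleCons 𝕜 (φ w) (n + 1) (tupleMap 𝕜 ψ (n + 1) (tupleCons 𝕜 w n x)) -
        tupleCons 𝕜 (φ w) (n + 1) (tuplePrism 𝕜 φ ψ n x) := by
  have : tuplePrism 𝕜 φ ψ (n + 1) ∘ₗ tupleCons 𝕜 w n =
      tupleCons 𝕜 (φ w) (n + 1) ∘ₗ tupleMap 𝕜 ψ (n + 1) ∘ₗ tupleCons 𝕜 w n -
        tupleCons 𝕜 (φ w) (n + 1) ∘ₗ tuplePrism 𝕜 φ ψ n := by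
    refine Finsupp.lhom_ext' fun v => LinearMap.ext_ring ?_
    simp [tuplePrism_single]
  exact LinearMap.congr_fun this x

theorem tupleBoundary_cons (n : ℕ) (w : V) (x : (Fin (n + 1) → V) →₀ 𝕜) :
    tupleBoundary 𝕜 V (n + 1) (tupleCons 𝕜 w (n + 1) x) =
      x - tupleCons 𝕜 w n (tupleBoundary 𝕜 V n x) := by
  have : tupleBoundary 𝕜 V (n + 1) ∘ₗ tupleCons 𝕜 w (n + 1) =
      LinearMap.id - tupleCons 𝕜 w n ∘ₗ tupleBoundary 𝕜 V n := by
    refine Finsupp.lhom_ext' fun v => LinearMap.ext_ring ?_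
    have h0 : (Fin.cons w v : Fin (n + 2) → V) ∘ Fin.succ = v := by
      ext i; simp
    have h : ∀ i : Fin (n + 1), (Fin.cons w v : Fin (n + 2) → V) ∘ i.succ.succAbove =
        (Fin.cons w (v ∘ i.succAbove) : Fin (n + 1) → V) := by
      intro i
      ext j
      refine Fin.cases ?_ (fun j => ?_) j <;> simp
    simp only [tupleBoundary, LinearMap.comp_apply, Finsupp.lsingle_apply, tupleCons_single,
      LinearMap.sum_apply, LinearMap.smul_apply, Finsupp.lmapDomain_apply,
      Finsupp.mapDomain_single, LinearMap.sub_apply, LinearMap.id_apply]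
    rw [Fin.sum_univ_succ]
    simp only [h, Fin.val_zero, pow_zero, Fin.succAbove_zero, h0, one_smul, Fin.val_succ,
      map_sum, map_smul, tupleCons_single, pow_succ, mul_neg_one, neg_smul,
      Finset.sum_neg_distrib, sub_eq_add_neg]
  exact LinearMap.congr_fun this x

theorem tupleBoundary_map (φ : V → W) (n : ℕ) (x : (Fin (n + 1) → V) →₀ 𝕜) :
    tupleBoundary 𝕜 W n (tupleMap 𝕜 φ (n + 1) x) = tupleMap 𝕜 φ n (tupleBoundary 𝕜 V n x) := by
  simp only [tupleBoundary, tupleMap, LinearMap.sum_apply, LinearMap.smul_apply, map_sum, map_smul,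
    Finsupp.lmapDomain_apply, ← Finsupp.mapDomain_comp]
  rfl

theorem single_eq_tupleCons (n : ℕ) (v : Fin (n + 1) → V) :
    (Finsupp.single v 1 : (Fin (n + 1) → V) →₀ 𝕜) =
      tupleCons 𝕜 (v 0) n (Finsupp.single (Fin.tail v) 1) := by
  simp

/-- The prism satisfies the cone recursion `P (v₀ * y) = φ v₀ * (ψ (v₀ * y) - P y)`, and `∂ (w * x)
= x - w * ∂ x`. Expanding both sides on `v₀ * y` and using the formula for the shorter `y` makes
everything cancel. The empty tuple is allowed, so that the cone formula also holds in the lowest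
degree. -/
theorem tupleBoundary_prism (φ ψ : V → W) (n : ℕ) (x : (Fin (n + 1) → V) →₀ 𝕜) :
    tupleBoundary 𝕜 W (n + 1) (tuplePrism 𝕜 φ ψ (n + 1) x) =
      tupleMap 𝕜 ψ (n + 1) x - tupleMap 𝕜 φ (n + 1) x -
        tuplePrism 𝕜 φ ψ n (tupleBoundary 𝕜 V n x) := by
  induction n with
  | zero =>
    have : tupleBoundary 𝕜 W 1 ∘ₗ tuplePrism 𝕜 φ ψ 1 = tupleMap 𝕜 ψ 1 - tupleMap 𝕜 φ 1 := by
      refine Finsupp.lhom_ext' fun v => LinearMap.ext_ring ?_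
      simp only [LinearMap.comp_apply, Finsupp.lsingle_apply, tuplePrism_single]
      rw [← tupleCons_single, map_sub, tupleBoundary_cons]
      have hb : tupleBoundary 𝕜 W 0 (Finsupp.single (ψ ∘ v) 1) = Finsupp.single Fin.elim0 1 := by
        simp [tupleBoundary, Subsingleton.elim _ (Fin.elim0 : Fin 0 → W)]
      rw [hb, tupleCons_single]
      simp only [tuplePrism, LinearMap.zero_apply, map_zero, sub_zero, LinearMap.sub_apply,
        tupleMap_single]
      congr 2
      ext i
      rw [Fin.fin_one_eq_zero i]
      simp
    simpa [tuplePrism] using LinearMap.congr_fun this x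
  | succ n ih =>
    have : tupleBoundary 𝕜 W (n + 2) ∘ₗ tuplePrism 𝕜 φ ψ (n + 2) =
        tupleMap 𝕜 ψ (n + 2) - tupleMap 𝕜 φ (n + 2) -
          tuplePrism 𝕜 φ ψ (n + 1) ∘ₗ tupleBoundary 𝕜 V (n + 1) := by
      refine Finsupp.lhom_ext' fun v => LinearMap.ext_ring ?_
      simp only [LinearMap.comp_apply, Finsupp.lsingle_apply, LinearMap.sub_apply]
      rw [single_eq_tupleCons]
      set y : (Fin (n + 1) → V) →₀ 𝕜 := Finsupp.single (Fin.tail v) 1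
      have hφ : tupleMap 𝕜 φ (n + 2) (tupleCons 𝕜 (v 0) (n + 1) y) =
          tupleCons 𝕜 (φ (v 0)) (n + 1) (tupleMap 𝕜 φ (n + 1) y) := by
        simp only [y, tupleCons_single, tupleMap_single]
        congr 1
        ext i
        refine Fin.cases ?_ (fun j => ?_) i <;> simp [Fin.tail]
      rw [tuplePrism_cons, map_sub, tupleBoundary_cons, tupleBoundary_cons, ih,
        tupleBoundary_map, tupleBoundary_cons, hφ]
      simp only [map_sub, tuplePrism_cons]
      abel
    exact LinearMap.congr_fun this x

/-- The homotopy is built without reference to any complex. This control of its vertices is what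
places it inside the target complex when the two maps are contiguous. -/
theorem tuplePrism_mem_supported (φ ψ : V → W) (n : ℕ) (v : Fin n → V) :
    tuplePrism 𝕜 φ ψ n (Finsupp.single v 1) ∈ Finsupp.supported 𝕜 𝕜
      {w : Fin (n + 1) → W | Set.range w ⊆ Set.range (φ ∘ v) ∪ Set.range (ψ ∘ v)} := by
  induction n with
  | zero => simp [tuplePrism]
  | succ n ih =>
    rw [tuplePrism_single]
    refine Submodule.sub_mem _ (Finsupp.single_mem_supported _ _ ?_) ?_
    · rintro _ ⟨i, rfl⟩
      refine Fin.cases (Or.inl ⟨0, by simp⟩) (fun j => Or.inr ⟨j, by simp⟩) i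
    · have h := Submodule.mem_map_of_mem (f := tupleCons 𝕜 (φ (v 0)) (n + 1)) (ih (Fin.tail v))
      rw [tupleCons, Finsupp.lmapDomain_supported] at h
      refine Finsupp.supported_mono ?_ h
      rintro _ ⟨w, hw, rfl⟩ _ ⟨i, rfl⟩
      refine Fin.cases (Or.inl ⟨0, by simp⟩) (fun j => ?_) i
      rcases hw ⟨j, rfl⟩ with ⟨l, hl⟩ | ⟨l, hl⟩
      · exact Or.inl ⟨l.succ, by simpa [Fin.tail] using hl⟩
      · exact Or.inr ⟨l.succ, by simpa [Fin.tail] using hl⟩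

end Tuples

/-! ### From tuples back to chains: contiguous maps in homology -/

section Contiguity

variable (𝕜 : Type*) [Field 𝕜] {V W : Type*} {K : PreAbstractSimplicialComplex V}
  {L : PreAbstractSimplicialComplex W}

/-- Chains of a complex as formal combinations of tuples. -/
def Chains.toTuples (K : PreAbstractSimplicialComplex V) (n : ℕ) :
    Chains 𝕜 K n →ₗ[𝕜] ((Fin (n + 1) → V) →₀ 𝕜) :=
  (Finsupp.lmapDomain 𝕜 𝕜 Subtype.val : (OrderedSimplex K n →₀ 𝕜) →ₗ[𝕜] _)

theorem Chains.toTuples_injective (n : ℕ) : Function.Injective (Chains.toTuples 𝕜 K n) :=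
  Finsupp.mapDomain_injective Subtype.val_injective

theorem Chains.toTuples_chainsMapDomain {m n : ℕ} (F : OrderedSimplex K m → OrderedSimplex L n)
    (G : (Fin (m + 1) → V) → (Fin (n + 1) → W)) (h : ∀ v, (F v).1 = G v.1) (x : Chains 𝕜 K m) :
    Chains.toTuples 𝕜 L n (chainsMapDomain 𝕜 F x) =
      Finsupp.lmapDomain 𝕜 𝕜 G (Chains.toTuples 𝕜 K m x) := by
  have hc : (Subtype.val : OrderedSimplex L n → _) ∘ F = G ∘ Subtype.val := funext h
  refine (Finsupp.mapDomain_comp (f := F) (g := Subtype.val)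
    (v := (x : OrderedSimplex K m →₀ 𝕜))).symm.trans ?_
  refine (congrArg (fun q => Finsupp.mapDomain q (x : OrderedSimplex K m →₀ 𝕜)) hc).trans ?_
  exact Finsupp.mapDomain_comp (f := Subtype.val) (g := G) (v := (x : OrderedSimplex K m →₀ 𝕜))

theorem Chains.toTuples_boundary (n : ℕ) (x : Chains 𝕜 K (n + 1)) :
    Chains.toTuples 𝕜 K n (boundary 𝕜 K n x) =
      tupleBoundary 𝕜 V (n + 1) (Chains.toTuples 𝕜 K (n + 1) x) := by
  simp only [boundary, tupleBoundary, LinearMap.sum_apply, LinearMap.smul_apply, map_sum, map_smul]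
  refine Finset.sum_congr rfl fun i _ => ?_
  congr 1
  exact Chains.toTuples_chainsMapDomain 𝕜 _ _ (fun _ => rfl) x

theorem Chains.toTuples_chainMap (φ : SimplicialMap K L) (n : ℕ) (x : Chains 𝕜 K n) :
    Chains.toTuples 𝕜 L n (chainMap 𝕜 φ n x) =
      tupleMap 𝕜 φ.toFun (n + 1) (Chains.toTuples 𝕜 K n x) :=
  Chains.toTuples_chainsMapDomain 𝕜 _ _ (fun _ => rfl) x

theorem Chains.exists_toTuples_eq (n : ℕ) (y : (Fin (n + 1) → V) →₀ 𝕜)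
    (hy : y ∈ Finsupp.supported 𝕜 𝕜 {v | (Set.finite_range v).toFinset ∈ K.faces}) :
    ∃ x, Chains.toTuples 𝕜 K n x = y := by
  have h := Finsupp.lmapDomain_supported 𝕜 𝕜 (Subtype.val : OrderedSimplex K n → _) Set.univ
  rw [Set.image_univ, Finsupp.supported_univ] at h
  have hy' : y ∈ Finsupp.supported 𝕜 𝕜 (Set.range (Subtype.val : OrderedSimplex K n → _)) := by
    refine Finsupp.supported_mono (fun v hv => ?_) hy
    exact ⟨⟨v, hv⟩, rfl⟩
  rw [← h] at hy'
  obtain ⟨x, -, hx⟩ := hy'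
  exact ⟨x, hx⟩

/-- Two simplicial maps are contiguous if the images of every simplex span a common simplex. -/
def Contiguous (φ ψ : SimplicialMap K L) : Prop :=
  ∀ σ ∈ K.faces, ∃ τ ∈ L.faces, ∀ x ∈ σ, φ.toFun x ∈ τ ∧ ψ.toFun x ∈ τ

/-- Contiguous simplicial maps induce the same map on homology. -/
theorem Contiguous.homologyMap_eq {φ ψ : SimplicialMap K L} (h : Contiguous φ ψ) (k : ℕ) :
    homologyMap 𝕜 φ k = homologyMap 𝕜 ψ k := by
  refine LinearMap.ext fun x => ?_
  obtain ⟨⟨z, hz⟩, rfl⟩ := Submodule.Quotient.mk_surjective _ x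
  refine Eq.symm ?_
  change Submodule.Quotient.mk (cyclesMap 𝕜 ψ k ⟨z, hz⟩) =
    Submodule.Quotient.mk (cyclesMap 𝕜 φ k ⟨z, hz⟩)
  rw [Submodule.Quotient.eq]
  have hsup : ∀ y : Chains 𝕜 K k, tuplePrism 𝕜 φ.toFun ψ.toFun (k + 1) (Chains.toTuples 𝕜 K k y) ∈
      Finsupp.supported 𝕜 𝕜 {v | (Set.finite_range v).toFinset ∈ L.faces} := by
    intro y
    refine Finsupp.induction_linear (motive := fun y : OrderedSimplex K k →₀ 𝕜 =>
      tuplePrism 𝕜 φ.toFun ψ.toFun (k + 1) (Chains.toTuples 𝕜 K k y) ∈ Finsupp.supported 𝕜 𝕜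
        {v | (Set.finite_range v).toFinset ∈ L.faces}) y ?_ ?_ ?_
    · have h0 : Chains.toTuples 𝕜 K k (0 : OrderedSimplex K k →₀ 𝕜) = 0 :=
        map_zero (Chains.toTuples 𝕜 K k)
      rw [h0, map_zero]
      exact Submodule.zero_mem _
    · intro a b ha hb
      have h0 : Chains.toTuples 𝕜 K k (a + b : OrderedSimplex K k →₀ 𝕜) =
        Chains.toTuples 𝕜 K k a + Chains.toTuples 𝕜 K k b :=
          map_add (Chains.toTuples 𝕜 K k) _ _
      rw [h0, map_add]
      exact Submodule.add_mem _ ha hb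
    · intro v a
      have h0 : Chains.toTuples 𝕜 K k (Finsupp.single v a : OrderedSimplex K k →₀ 𝕜) =
          a • Finsupp.single v.1 1 := by
        rw [Finsupp.smul_single', mul_one]
        exact Finsupp.mapDomain_single
      rw [h0, map_smul]
      refine Submodule.smul_mem _ _ (Finsupp.supported_mono ?_
        (tuplePrism_mem_supported φ.toFun ψ.toFun (k + 1) v.1))
      intro w hw
      obtain ⟨τ, hτ, hv⟩ := h _ v.2
      refine (L.isRelLowerSet_faces hτ).2 (fun y hy => ?_) ⟨w 0, by simp⟩
      simp only [Set.Finite.mem_toFinset] at hy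
      rcases hw hy with ⟨i, rfl⟩ | ⟨i, rfl⟩
      · exact (hv (v.1 i) (by simp)).1
      · exact (hv (v.1 i) (by simp)).2
  obtain ⟨y, hy⟩ := Chains.exists_toTuples_eq 𝕜 (K := L) (k + 1) _ (hsup z)
  refine ⟨y, Chains.toTuples_injective 𝕜 (K := L) k ?_⟩
  change _ = Chains.toTuples 𝕜 L k (chainMap 𝕜 ψ k z - chainMap 𝕜 φ k z)
  rw [Chains.toTuples_boundary, hy, tupleBoundary_prism, map_sub, Chains.toTuples_chainMap,
    Chains.toTuples_chainMap]
  -- The term `P ∂ z` vanishes for two different reasons: in degree `0` because the prism of the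
  -- empty tuple is zero, in higher degrees because `z` is a cycle.
  suffices hD : tuplePrism 𝕜 φ.toFun ψ.toFun k (tupleBoundary 𝕜 V k (Chains.toTuples 𝕜 K k z)) = 0 by
    rw [hD, sub_zero]
  cases k with
  | zero => simp [tuplePrism]
  | succ k =>
    have hz' : boundary 𝕜 K k z = 0 := hz
    rw [← Chains.toTuples_boundary, hz', map_zero, map_zero]

end Contiguity

/-! ### Rank functions and the points of their persistence diagrams -/

/-- The monotonicity properties of the rank function of a persistence module. -/
structure RankLike (r : ℝ → ℝ → ℕ) : Prop where
  mono : ∀ p q t, p ≤ q → q ≤ t → r p t ≤ r q t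
  anti : ∀ q t t', q ≤ t → t ≤ t' → r q t' ≤ r q t
  box : ∀ p q t t', p ≤ q → q ≤ t → t ≤ t' → r p t + r q t' ≤ r q t + r p t'

/-- The number of intervals which are born in `[p, q]` and die in `[t, t']`. -/
def boxCount (r : ℝ → ℝ → ℕ) (p q t t' : ℝ) : ℕ :=
  (r q t + r p t') - (r p t + r q t')

/-- No interval is born or dies at `x`. -/
def IsRegular (r : ℝ → ℝ → ℕ) (x : ℝ) : Prop :=
  (∀ t, x < t → ∃ p q, p < x ∧ x < q ∧ q < t ∧ r p t = r q t) ∧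
    ∀ b, b < x → ∃ t t', b < t ∧ t < x ∧ x < t' ∧ r b t = r b t'

/-- A family of points in the half plane above the diagonal is the diagram of a rank function. -/
structure Represents {P : Type*} (r : ℝ → ℝ → ℕ) (β δ : P → ℝ) : Prop where
  lt : ∀ z, β z < δ z
  encard_fiber : ∀ x y : ℝ, x < y → {z | β z = x ∧ δ z = y}.encard = multiplicity r x (y : ℝ)

section RankLike

variable {r : ℝ → ℝ → ℕ}

theorem multiplicity_le_boxCount {b d p q t t' : ℝ} (h₁ : p < b) (h₂ : b < q) (h₃ : q < t)
    (h₄ : t < d) (h₅ : d < t') : multiplicity r b (d : ℝ) ≤ boxCount r p q t t' :=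
  Nat.sInf_le ⟨p, q, t, t', h₁, h₂, h₃, h₄, h₅, rfl⟩

theorem RankLike.boxCount_mono (hr : RankLike r) {p p' q' q t s s' t' : ℝ} (h₁ : p ≤ p')
    (h₂ : p' ≤ q') (h₃ : q' ≤ q) (h₄ : q ≤ t) (h₅ : t ≤ s) (h₆ : s ≤ s') (h₇ : s' ≤ t') :
    boxCount r p' q' s s' ≤ boxCount r p q t t' := by
  have a₁ := hr.box p p' t t' h₁ (by linarith) (by linarith)
  have a₂ := hr.box q' q t t' h₃ (by linarith) (by linarith)
  have a₃ := hr.box p' q' t s h₂ (by linarith) (by linarith)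
  have a₄ := hr.box p' q' s' t' h₂ (by linarith) (by linarith)
  have a₅ := hr.box p' q' s s' h₂ (by linarith) (by linarith)
  unfold boxCount
  omega

theorem RankLike.boxCount_add_left (hr : RankLike r) {p e q t t' : ℝ} (h₁ : p ≤ e)
    (h₂ : e ≤ q) (h₃ : q ≤ t) (h₄ : t ≤ t') :
    boxCount r p q t t' = boxCount r p e t t' + boxCount r e q t t' := by
  have a₁ := hr.box p e t t' h₁ (by linarith) h₄
  have a₂ := hr.box e q t t' h₂ h₃ h₄
  unfold boxCount
  omega

theorem RankLike.boxCount_add_right (hr : RankLike r) {p q t e t' : ℝ} (h₁ : p ≤ q)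
    (h₂ : q ≤ t) (h₃ : t ≤ e) (h₄ : e ≤ t') :
    boxCount r p q t t' = boxCount r p q t e + boxCount r p q e t' := by
  have a₁ := hr.box p q t e h₁ h₂ h₃
  have a₂ := hr.box p q e t' h₁ (by linarith) h₄
  unfold boxCount
  omega

/-- An infimum of natural numbers is attained, and shrinking an optimal box keeps it optimal because
box counts are monotone. So the optimal box can be taken inside any prescribed neighbourhood. -/
theorem RankLike.exists_boxCount_eq (hr : RankLike r) {b d p₀ q₀ t₀ t₁ : ℝ} (hbd : b < d)
    (hp : p₀ < b) (hq : b < q₀) (ht : t₀ < d) (ht' : d < t₁) :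
    ∃ p q t t', p₀ ≤ p ∧ p < b ∧ b < q ∧ q ≤ q₀ ∧ q < t ∧ t₀ ≤ t ∧ t < d ∧ d < t' ∧ t' ≤ t₁ ∧
      boxCount r p q t t' = multiplicity r b (d : ℝ) := by
  have hne : {n | ∃ p q t t' : ℝ, p < b ∧ b < q ∧ q < t ∧ t < d ∧ d < t' ∧
      n = (r q t + r p t') - (r p t + r q t')}.Nonempty := by
    obtain ⟨q, hq1, hq2⟩ := exists_between hbd
    obtain ⟨t, ht1, ht2⟩ := exists_between hq2
    exact ⟨_, b - 1, q, t, d + 1, by linarith, hq1, ht1, ht2, by linarith, rfl⟩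
  obtain ⟨p, q, t, t', h₁, h₂, h₃, h₄, h₅, h₆⟩ := Nat.sInf_mem hne
  have h₆' : boxCount r p q t t' = multiplicity r b (d : ℝ) := h₆.symm
  refine ⟨max p p₀, min q q₀, max t t₀, min t' t₁, le_max_right _ _, max_lt h₁ hp, lt_min h₂ hq,
    min_le_right _ _, lt_of_le_of_lt (min_le_left _ _) (lt_of_lt_of_le h₃ (le_max_left _ _)),
    le_max_right _ _, max_lt h₄ ht, lt_min h₅ ht', min_le_right _ _, le_antisymm ?_ ?_⟩
  · rw [← h₆']
    exact hr.boxCount_mono (le_max_left _ _) ((max_lt h₁ hp).trans (lt_min h₂ hq)).le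
      (min_le_left _ _) h₃.le (le_max_left _ _) ((max_lt h₄ ht).trans (lt_min h₅ ht')).le
      (min_le_left _ _)
  · exact multiplicity_le_boxCount (max_lt h₁ hp) (lt_min h₂ hq)
      (lt_of_le_of_lt (min_le_left _ _) (lt_of_lt_of_le h₃ (le_max_left _ _)))
      (max_lt h₄ ht) (lt_min h₅ ht')

/-- The multiplicity of a point only depends on the rank function near that point. -/
theorem RankLike.multiplicity_congr {r' : ℝ → ℝ → ℕ} (hr : RankLike r) (hr' : RankLike r')
    {b d p₀ q₀ t₀ t₁ : ℝ} (hbd : b < d) (hp : p₀ < b) (hq : b < q₀) (ht : t₀ < d) (ht' : d < t₁)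
    (h : ∀ x y, p₀ ≤ x → x ≤ q₀ → t₀ ≤ y → y ≤ t₁ → r x y = r' x y) :
    multiplicity r b (d : ℝ) = multiplicity r' b (d : ℝ) := by
  apply le_antisymm
  · obtain ⟨p, q, t, t', h₁, h₂, h₃, h₄, h₅, h₆, h₇, h₈, h₉, e⟩ :=
      hr'.exists_boxCount_eq hbd hp hq ht ht'
    refine (multiplicity_le_boxCount h₂ h₃ h₅ h₇ h₈).trans_eq (Eq.trans ?_ e)
    unfold boxCount
    rw [h, h, h, h] <;> linarith
  · obtain ⟨p, q, t, t', h₁, h₂, h₃, h₄, h₅, h₆, h₇, h₈, h₉, e⟩ :=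
      hr.exists_boxCount_eq hbd hp hq ht ht'
    refine (multiplicity_le_boxCount h₂ h₃ h₅ h₇ h₈).trans_eq (Eq.trans ?_ e)
    unfold boxCount
    rw [h, h, h, h] <;> linarith

/-- A monotone function has countably many discontinuities, and continuity into the discrete space
`ℕ` is local constancy. -/
theorem countable_setOf_not_locally_constant {f : ℝ → ℕ} {τ : ℝ}
    (hf : MonotoneOn f (Set.Iio τ)) :
    {x | x < τ ∧ ∀ p q, p < x → x < q → q < τ → f p ≠ f q}.Countable := by
  refine hf.countable_not_continuousWithinAt.mono ?_
  rintro x ⟨hx, h⟩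
  refine ⟨hx, fun hc => ?_⟩
  rw [continuousWithinAt_iff_continuousAt (Iio_mem_nhds hx)] at hc
  have h1 : ∀ᶠ y in nhds x, f y = f x := Filter.Tendsto.eventually (p := fun n => n = f x) (show Filter.Tendsto f (nhds x) (nhds (f x)) from hc)
    (mem_nhds_discrete.2 rfl)
  obtain ⟨l, u, ⟨hl, hu⟩, hlu⟩ := mem_nhds_iff_exists_Ioo_subset.1
    (h1.and (Iio_mem_nhds hx))
  obtain ⟨p, hp1, hp2⟩ := exists_between hl
  obtain ⟨q, hq1, hq2⟩ := exists_between hu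
  have e1 := hlu ⟨hp1, hp2.trans hu⟩
  have e2 := hlu ⟨hl.trans hq1, hq2⟩
  exact h p q hp2 hq1 e2.2 (e1.1.trans e2.1.symm)

theorem countable_setOf_not_locally_constant' {f : ℝ → ℕ} {τ : ℝ}
    (hf : AntitoneOn f (Set.Ioi τ)) :
    {x | τ < x ∧ ∀ t t', τ < t → t < x → x < t' → f t ≠ f t'}.Countable := by
  have hg : MonotoneOn (fun x => f (-x)) (Set.Iio (-τ)) := by
    intro a ha b hb hab
    exact hf (by simp at hb ⊢; linarith) (by simp at ha ⊢; linarith) (neg_le_neg hab)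
  refine ((countable_setOf_not_locally_constant hg).image Neg.neg).mono ?_
  rintro x ⟨hx, h⟩
  refine ⟨-x, ⟨by linarith, fun p q hp hq hqτ he => ?_⟩, by simp⟩
  exact h (-q) (-p) (by linarith) (by linarith) (by linarith) he.symm

/-- It suffices to test rational `τ`: by the box inequality, an equality `r p τ = r q τ` persists
for every `t ≥ τ`, and `r τ t = r τ t'` persists for every `b ≤ τ`. For fixed `τ` the exceptional
set is countable by monotonicity. -/
theorem RankLike.countable_not_isRegular (hr : RankLike r) : {x | ¬ IsRegular r x}.Countable := by
  have h1 : ∀ τ : ℚ, {x : ℝ | x < τ ∧ ∀ p q, p < x → x < q → q < τ → r p τ ≠ r q τ}.Countable :=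
    fun τ => countable_setOf_not_locally_constant (f := fun x => r x τ)
      (fun a _ b hb hab => hr.mono _ _ _ hab (le_of_lt hb))
  have h2 : ∀ τ : ℚ, {x : ℝ | τ < x ∧ ∀ t t' : ℝ, τ < t → t < x → x < t' → r τ t ≠ r τ t'}.Countable :=
    fun τ => countable_setOf_not_locally_constant' (f := fun x => r τ x)
      (fun a ha b _ hab => hr.anti _ _ _ (le_of_lt ha) hab)
  refine ((Set.countable_iUnion h1).union (Set.countable_iUnion h2)).mono ?_
  intro x hx
  by_contra hcon
  simp only [Set.mem_union, Set.mem_iUnion, Set.mem_ofPred_eq, not_or, not_exists, not_and] at hcon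
  obtain ⟨c1, c2⟩ := hcon
  push Not at c1 c2
  refine hx ⟨fun t hxt => ?_, fun b hbx => ?_⟩
  · obtain ⟨τ, hτ1, hτ2⟩ := exists_rat_btwn hxt
    obtain ⟨p, q, hp, hq, hqτ, he⟩ := c1 τ hτ1
    refine ⟨p, q, hp, hq, hqτ.trans hτ2, ?_⟩
    have a1 := hr.box p q τ t (by linarith) hqτ.le hτ2.le
    have a2 := hr.mono p q t (by linarith) (by linarith)
    omega
  · obtain ⟨τ, hτ1, hτ2⟩ := exists_rat_btwn hbx
    obtain ⟨t, t', hp, hq, hqτ, he⟩ := c2 τ hτ2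
    refine ⟨t, t', hτ1.trans hp, hq, hqτ, ?_⟩
    have a1 := hr.box b τ t t' hτ1.le hp.le (by linarith)
    have a2 := hr.anti b t t' (by linarith) (by linarith)
    omega

theorem RankLike.exists_isRegular_between (hr : RankLike r) {a b : ℝ} (hab : a < b) :
    ∃ x, a < x ∧ x < b ∧ IsRegular r x := by
  obtain ⟨x, hx, hx'⟩ := (hr.countable_not_isRegular.dense_compl ℝ).exists_between hab
  exact ⟨x, hx'.1, hx'.2, not_not.1 hx⟩

end RankLike

/-- A transitive relation between regular values that holds locally holds globally. -/
theorem rel_of_local {R : ℝ → Prop} {P : ℝ → ℝ → Prop} {a b : ℝ}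
    (hR : ∀ x y, x < y → ∃ z, x < z ∧ z < y ∧ R z)
    (htrans : ∀ u v w, R u → R v → R w → a ≤ u → u < v → v < w → w ≤ b → P u v → P v w → P u w)
    (hloc : ∀ x, a ≤ x → x ≤ b → ∃ p q, p < x ∧ x < q ∧ ∀ u v, R u → R v →
      a ≤ u → v ≤ b → p < u → u < v → v < q → P u v)
    (hab : a < b) (ha : R a) (hb : R b) : P a b := by
  -- Continuous induction on `sSup S`. The point `a` is put in by hand because `P a a` is not
  -- assumed; regular values just beyond the supremum would contradict its maximality unless it
  -- equals `b`.
  set S : Set ℝ := {x | a ≤ x ∧ x ≤ b ∧ (x = a ∨ R x ∧ P a x)} with hS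
  have haS : a ∈ S := ⟨le_rfl, hab.le, Or.inl rfl⟩
  have hbdd : BddAbove S := ⟨b, fun x hx => hx.2.1⟩
  set s := sSup S with hs
  have has : a ≤ s := le_csSup hbdd haS
  have hsb : s ≤ b := csSup_le ⟨a, haS⟩ fun x hx => hx.2.1
  obtain ⟨p, q, hp, hq, h⟩ := hloc s has hsb
  obtain ⟨x, hxS, hpx⟩ := exists_lt_of_lt_csSup ⟨a, haS⟩ hp
  have hxs : x ≤ s := le_csSup hbdd hxS
  have key : ∀ v, R v → x < v → v ≤ b → v < q → P a v := by
    intro v hv hxv hvb hvq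
    rcases hxS.2.2 with rfl | ⟨hx1, hx2⟩
    · exact h _ _ ha hv le_rfl hvb hpx hxv hvq
    · rcases hxS.1.eq_or_lt with rfl | hax
      · exact h _ _ ha hv le_rfl hvb hpx hxv hvq
      · exact htrans a x v ha hx1 hv le_rfl hax hxv hvb hx2
          (h _ _ hx1 hv hxS.1 hvb hpx hxv hvq)
  rcases hsb.eq_or_lt with hsb' | hsb'
  · rcases hxS.2.1.eq_or_lt with hxb | hxb
    · rcases hxS.2.2 with rfl | ⟨-, h2⟩
      · exact absurd hxb hab.ne
      · rwa [hxb] at h2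
    · exact key b hb hxb le_rfl (hsb' ▸ hq)
  · obtain ⟨v, hv1, hv2, hv3⟩ := hR s (min q b) (lt_min hq hsb')
    have hvb : v ≤ b := (hv2.trans_le (min_le_right _ _)).le
    have hvS : v ∈ S := ⟨has.trans hv1.le, hvb, Or.inr
      ⟨hv3, key v hv3 (hxs.trans_lt hv1) hvb (hv2.trans_le (min_le_left _ _))⟩⟩
    exact absurd (le_csSup hbdd hvS) (not_le.2 hv1)

/-! ### Counting diagram points in boxes with regular sides -/

section Represents

variable {r : ℝ → ℝ → ℕ} {P : Type*} {β δ : P → ℝ}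

theorem Represents.multiplicity_pos (h : Represents r β δ) (z : P) :
    0 < multiplicity r (β z) (δ z : ℝ) := by
  have h1 := h.encard_fiber _ _ (h.lt z)
  by_contra hcon
  rw [Nat.eq_zero_of_not_pos hcon, Nat.cast_zero, Set.encard_eq_zero] at h1
  exact Set.eq_empty_iff_forall_notMem.1 h1 z ⟨rfl, rfl⟩

theorem Represents.boxCount_pos (h : Represents r β δ) (z : P) {p q t t' : ℝ} (h₁ : p < β z)
    (h₂ : β z < q) (h₃ : q < t) (h₄ : t < δ z) (h₅ : δ z < t') : 0 < boxCount r p q t t' :=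
  (h.multiplicity_pos z).trans_le (multiplicity_le_boxCount h₁ h₂ h₃ h₄ h₅)

theorem Represents.birth_ne (h : Represents r β δ) (hr : RankLike r) {x : ℝ} (hx : IsRegular r x)
    (z : P) : β z ≠ x := by
  rintro rfl
  obtain ⟨t, ht1, ht2⟩ := exists_between (h.lt z)
  obtain ⟨p, q, hp, hq, hqt, he⟩ := hx.1 t ht1
  have h1 := h.boxCount_pos z hp hq hqt ht2 (lt_add_one _)
  have h2 := hr.mono p q (δ z + 1) (by linarith) (by linarith)
  unfold boxCount at h1
  omega

theorem Represents.death_ne (h : Represents r β δ) (hr : RankLike r) {x : ℝ} (hx : IsRegular r x)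
    (z : P) : δ z ≠ x := by
  rintro rfl
  obtain ⟨b, hb1, hb2⟩ := exists_between (h.lt z)
  obtain ⟨t, t', hp, hq, hqt, he⟩ := hx.2 b hb2
  have h1 := h.boxCount_pos z (sub_one_lt _) hb1 hp hq hqt
  have h2 := hr.anti (β z - 1) t t' (by linarith) (by linarith)
  unfold boxCount at h1
  omega

/-- The number of points in a box is the one given by the rank function. -/
def CountsBox (r : ℝ → ℝ → ℕ) (β δ : P → ℝ) (u v w y : ℝ) : Prop :=
  {z | u < β z ∧ β z < v ∧ w < δ z ∧ δ z < y}.encard = boxCount r u v w y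

/-- Box counts are additive under a vertical cut. The number of points is too, provided no point
lies on the cut, which regularity of `e` guarantees. -/
theorem Represents.countsBox_trans_left (h : Represents r β δ) (hr : RankLike r)
    {u e v w y : ℝ} (he : IsRegular r e) (h₁ : u < e) (h₂ : e < v) (h₃ : v ≤ w) (h₄ : w ≤ y)
    (c₁ : CountsBox r β δ u e w y) (c₂ : CountsBox r β δ e v w y) : CountsBox r β δ u v w y := by
  unfold CountsBox at *
  rw [hr.boxCount_add_left h₁.le h₂.le h₃ h₄, Nat.cast_add, ← c₁, ← c₂, ← Set.encard_union_eq]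
  · congr 1
    ext z
    have := h.birth_ne hr he z
    simp only [Set.mem_ofPred_eq, Set.mem_union]
    constructor
    · rintro ⟨a1, a2, a3, a4⟩
      rcases lt_or_gt_of_ne this with h5 | h5
      · exact Or.inl ⟨a1, h5, a3, a4⟩
      · exact Or.inr ⟨h5, a2, a3, a4⟩
    · rintro (⟨a1, a2, a3, a4⟩ | ⟨a1, a2, a3, a4⟩)
      · exact ⟨a1, a2.trans h₂, a3, a4⟩
      · exact ⟨h₁.trans a1, a2, a3, a4⟩
  · rw [Set.disjoint_left]
    rintro z ⟨-, a2, -⟩ ⟨a1, -⟩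
    exact lt_asymm a1 a2

theorem Represents.countsBox_trans_right (h : Represents r β δ) (hr : RankLike r)
    {u v w e y : ℝ} (he : IsRegular r e) (h₁ : u ≤ v) (h₂ : v ≤ w) (h₃ : w < e) (h₄ : e < y)
    (c₁ : CountsBox r β δ u v w e) (c₂ : CountsBox r β δ u v e y) : CountsBox r β δ u v w y := by
  unfold CountsBox at *
  rw [hr.boxCount_add_right h₁ h₂ h₃.le h₄.le, Nat.cast_add, ← c₁, ← c₂, ← Set.encard_union_eq]
  · congr 1
    ext z
    have := h.death_ne hr he z
    simp only [Set.mem_ofPred_eq, Set.mem_union]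
    constructor
    · rintro ⟨a1, a2, a3, a4⟩
      rcases lt_or_gt_of_ne this with h5 | h5
      · exact Or.inl ⟨a1, a2, a3, h5⟩
      · exact Or.inr ⟨a1, a2, h5, a4⟩
    · rintro (⟨a1, a2, a3, a4⟩ | ⟨a1, a2, a3, a4⟩)
      · exact ⟨a1, a2, a3, a4.trans h₄⟩
      · exact ⟨a1, a2, h₃.trans a3, a4⟩
  · rw [Set.disjoint_left]
    rintro z ⟨-, -, -, a2⟩ ⟨-, -, a1, -⟩
    exact lt_asymm a1 a2

/-- Take a box around `(x, y)` whose count equals the multiplicity there. A point of the family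
elsewhere in it could be cut off by a line: its side would count at least one and the other side at
least the multiplicity, which is too much. So all points in the box sit at `(x, y)`. -/
theorem Represents.countsBox_local (h : Represents r β δ) (hr : RankLike r) {x y : ℝ}
    (hxy : x < y) :
    ∃ p q t t', p < x ∧ x < q ∧ q < t ∧ t < y ∧ y < t' ∧ ∀ u v w e, IsRegular r u →
      IsRegular r v → IsRegular r w → IsRegular r e → p < u → u < v → v < q → t < w → w < e →
        e < t' → CountsBox r β δ u v w e := by
  obtain ⟨p, q, t, t', -, hp, hq, -, hqt, -, ht, ht', -, hm⟩ := hr.exists_boxCount_eq hxy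
    (sub_one_lt x) (lt_add_one x) (sub_one_lt y) (lt_add_one y)
  refine ⟨p, q, t, t', hp, hq, hqt, ht, ht', ?_⟩
  have uniq : ∀ z, p < β z → β z < q → t < δ z → δ z < t' → β z = x ∧ δ z = y := by
    intro z h1 h2 h3 h4
    constructor
    · by_contra hne
      rcases lt_or_gt_of_ne hne with hlt | hlt
      · obtain ⟨e, he1, he2⟩ := exists_between hlt
        have a1 := hr.boxCount_add_left (p := p) (e := e) (q := q) (t := t) (t' := t')
          (by linarith) (by linarith) (by linarith) (by linarith)
        have a2 := h.boxCount_pos z h1 he1 (by linarith) h3 h4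
        have a3 := multiplicity_le_boxCount (r := r) he2 hq hqt ht ht'
        omega
      · obtain ⟨e, he1, he2⟩ := exists_between hlt
        have a1 := hr.boxCount_add_left (p := p) (e := e) (q := q) (t := t) (t' := t')
          (by linarith) (by linarith) (by linarith) (by linarith)
        have a2 := h.boxCount_pos z he2 h2 (by linarith) h3 h4
        have a3 := multiplicity_le_boxCount (r := r) hp he1 (by linarith : e < t) ht ht'
        omega
    · by_contra hne
      rcases lt_or_gt_of_ne hne with hlt | hlt
      · obtain ⟨e, he1, he2⟩ := exists_between hlt
        have a1 := hr.boxCount_add_right (p := p) (q := q) (t := t) (e := e) (t' := t')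
          (by linarith) (by linarith) (by linarith) (by linarith)
        have a2 := h.boxCount_pos z h1 h2 (by linarith) h3 he1
        have a3 := multiplicity_le_boxCount (r := r) hp hq (by linarith : q < e) he2 ht'
        omega
      · obtain ⟨e, he1, he2⟩ := exists_between hlt
        have a1 := hr.boxCount_add_right (p := p) (q := q) (t := t) (e := e) (t' := t')
          (by linarith) (by linarith) (by linarith) (by linarith)
        have a2 := h.boxCount_pos z h1 h2 (by linarith) he2 h4
        have a3 := multiplicity_le_boxCount (r := r) hp hq (by linarith : q < t) ht he1
        omega
  intro u v w e hu hv hw he pu uv vq tw we et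
  unfold CountsBox
  by_cases hin : u < x ∧ x < v ∧ w < y ∧ y < e
  · obtain ⟨i1, i2, i3, i4⟩ := hin
    have hset : {z | u < β z ∧ β z < v ∧ w < δ z ∧ δ z < e} = {z | β z = x ∧ δ z = y} := by
      ext z
      constructor
      · rintro ⟨a1, a2, a3, a4⟩
        exact uniq z (pu.trans a1) (a2.trans vq) (tw.trans a3) (a4.trans et)
      · rintro ⟨a1, a2⟩
        simp only [Set.mem_ofPred_eq, a1, a2]
        exact ⟨i1, i2, i3, i4⟩
    rw [hset, h.encard_fiber x y hxy]
    congr 1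
    apply le_antisymm (multiplicity_le_boxCount i1 i2 (by linarith) i3 i4)
    rw [← hm]
    exact hr.boxCount_mono pu.le uv.le vq.le hqt.le tw.le we.le et.le
  · have hset : {z | u < β z ∧ β z < v ∧ w < δ z ∧ δ z < e} = ∅ := by
      ext z
      simp only [Set.mem_ofPred_eq, Set.mem_empty_iff_false, iff_false]
      rintro ⟨a1, a2, a3, a4⟩
      obtain ⟨e1, e2⟩ := uniq z (pu.trans a1) (a2.trans vq) (tw.trans a3) (a4.trans et)
      rw [e1] at a1 a2
      rw [e2] at a3 a4
      exact hin ⟨a1, a2, a3, a4⟩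
    rw [hset, Set.encard_empty, eq_comm, Nat.cast_eq_zero]
    have hle := hr.boxCount_mono pu.le uv.le vq.le hqt.le tw.le we.le et.le
    rcases Nat.eq_zero_or_pos (multiplicity r x (y : ℝ)) with h0 | h0
    · omega
    have hne : {z | β z = x ∧ δ z = y}.Nonempty := by
      rw [← Set.encard_ne_zero, h.encard_fiber x y hxy]
      exact_mod_cast h0.ne'
    obtain ⟨z, rfl, rfl⟩ := hne
    have n1 := h.birth_ne hr hu z
    have n2 := h.birth_ne hr hv z
    have n3 := h.death_ne hr hw z
    have n4 := h.death_ne hr he z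
    -- A regular box that misses `(x, y)` lies strictly to one side of it. The part of the optimal
    -- box on the other side already accounts for the whole multiplicity, leaving zero for the small
    -- box.
    have hcase : β z < u ∨ v < β z ∨ δ z < w ∨ e < δ z := by
      by_contra hcon
      push Not at hcon
      exact hin ⟨lt_of_le_of_ne hcon.1 n1.symm, lt_of_le_of_ne hcon.2.1 n2,
        lt_of_le_of_ne hcon.2.2.1 n3.symm, lt_of_le_of_ne hcon.2.2.2 n4⟩
    rcases hcase with hc | hc | hc | hc
    · have a1 := hr.boxCount_add_left (p := p) (e := u) (q := q) (t := t) (t' := t')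
          (by linarith) (by linarith) (by linarith) (by linarith)
      have a2 := multiplicity_le_boxCount (r := r) hp hc (by linarith : u < t) ht ht'
      have a3 := hr.boxCount_mono le_rfl uv.le vq.le hqt.le tw.le we.le et.le
      omega
    · have a1 := hr.boxCount_add_left (p := p) (e := v) (q := q) (t := t) (t' := t')
          (by linarith) (by linarith) (by linarith) (by linarith)
      have a2 := multiplicity_le_boxCount (r := r) hc hq hqt ht ht'
      have a3 := hr.boxCount_mono pu.le uv.le le_rfl (by linarith : v ≤ t) tw.le we.le et.le
      omega
    · have a1 := hr.boxCount_add_right (p := p) (q := q) (t := t) (e := w) (t' := t')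
          (by linarith) (by linarith) (by linarith) (by linarith)
      have a2 := multiplicity_le_boxCount (r := r) hp hq hqt ht hc
      have a3 := hr.boxCount_mono pu.le uv.le vq.le (by linarith : q ≤ w) le_rfl we.le et.le
      omega
    · have a1 := hr.boxCount_add_right (p := p) (q := q) (t := t) (e := e) (t' := t')
          (by linarith) (by linarith) (by linarith) (by linarith)
      have a2 := multiplicity_le_boxCount (r := r) hp hq (by linarith : q < e) hc ht'
      have a3 := hr.boxCount_mono pu.le uv.le vq.le hqt.le tw.le we.le le_rfl
      omega

/-- The points of a diagram in a box with regular sides are counted by the rank function. -/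
theorem Represents.countsBox (h : Represents r β δ) (hr : RankLike r) {a b c d : ℝ}
    (ha : IsRegular r a) (hb : IsRegular r b) (hc : IsRegular r c) (hd : IsRegular r d)
    (hab : a < b) (hbc : b < c) (hcd : c < d) : CountsBox r β δ a b c d := by
  have hR : ∀ x y, x < y → ∃ z, x < z ∧ z < y ∧ IsRegular r z :=
    fun x y => hr.exists_isRegular_between
  refine rel_of_local (R := IsRegular r) (P := fun u v => CountsBox r β δ u v c d) hR ?_ ?_ hab ha hb
  · intro u v w _ hv _ _ huv hvw hwb h1 h2
    exact h.countsBox_trans_left hr hv huv hvw (by linarith) hcd.le h1 h2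
  intro x _ hxb
  -- Gluing is done twice. Here it runs over deaths, for births in an unspecified neighbourhood of
  -- `x` that shrinks to an intersection at each gluing; the outer application then runs over
  -- births. The bound `q < c` keeps the strips above the diagonal.
  have hstrip := rel_of_local (R := IsRegular r) (a := c) (b := d)
    (P := fun w y => ∃ p q, p < x ∧ x < q ∧ q < c ∧ ∀ u v, IsRegular r u → IsRegular r v → p < u →
      u < v → v < q → CountsBox r β δ u v w y) hR ?_ ?_ hcd hc hd
  · obtain ⟨p, q, hp, hq, -, H⟩ := hstrip
    exact ⟨p, q, hp, hq, fun u v hu hv _ _ => H u v hu hv⟩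
  · rintro w e y - he - hcw hwe hey - ⟨p, q, hp, hq, hqc, H⟩ ⟨p', q', hp', hq', hqc', H'⟩
    refine ⟨max p p', min q q', max_lt hp hp', lt_min hq hq', (min_le_left _ _).trans_lt hqc, ?_⟩
    intro u v hu hv hpu huv hvq
    rw [max_lt_iff] at hpu
    rw [lt_min_iff] at hvq
    exact h.countsBox_trans_right hr he huv.le (by linarith) hwe hey
      (H u v hu hv hpu.1 huv hvq.1) (H' u v hu hv hpu.2 huv hvq.2)
  · intro y hcy _
    obtain ⟨p, q, t, t', hp, hq, hqt, ht, ht', H⟩ := h.countsBox_local hr (x := x) (y := y)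
      (by linarith)
    obtain ⟨m, hm1, hm2⟩ := exists_between (show x < c by linarith)
    refine ⟨t, t', ht, ht', fun w e hw he _ _ htw hwe het =>
      ⟨p, min q m, hp, lt_min hq hm1, (min_le_right _ _).trans_lt hm2, fun u v hu hv hpu huv hvq =>
        H u v w e hu hv hw he hpu huv (hvq.trans_le (min_le_left _ _)) htw hwe het⟩⟩

end Represents

/-! ### Matchings of sorted families -/

/-- List the elements by decreasing value: the element at position `k`, counted from zero, exceeds
`t` exactly when more than `k` elements do. This turns inequalities between counts into inequalities
between values. -/
theorem exists_equiv_fin_sorted {P : Type*} (f : P → ℤ) {A : Set P} (hA : A.Finite) :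
    ∃ e : Fin (Nat.card A) ≃ A, ∀ k t, t < f (e k) ↔ ((k : ℕ) : ℕ∞) < {a ∈ A | t < f a}.encard := by
  have := hA.to_subtype
  let e₀ : Fin (Nat.card A) ≃ A := (Finite.equivFin A).symm
  let φ : Fin (Nat.card A) → ℤ := fun k => -f (e₀ k)
  refine ⟨(Tuple.sort φ).trans e₀, fun k t => ?_⟩
  set e := (Tuple.sort φ).trans e₀ with he
  have hanti : ∀ k l, k ≤ l → f (e l) ≤ f (e k) := by
    intro k l hkl
    have := Tuple.monotone_sort φ hkl
    simp only [φ, Function.comp_apply] at this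
    simp only [he, Equiv.trans_apply]
    linarith
  have hset : {a ∈ A | t < f a} = (fun k => ((e k : A) : P)) '' {k | t < f (e k)} := by
    ext a
    constructor
    · rintro ⟨ha, hta⟩
      refine ⟨e.symm ⟨a, ha⟩, ?_, congrArg Subtype.val (e.apply_symm_apply ⟨a, ha⟩)⟩
      change t < f (e (e.symm ⟨a, ha⟩))
      rwa [e.apply_symm_apply]
    · rintro ⟨k, hk, rfl⟩
      exact ⟨(e k).2, hk⟩
  have hinj : Function.Injective fun k => ((e k : A) : P) :=
    Subtype.val_injective.comp e.injective
  rw [hset, hinj.encard_image]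
  constructor
  · intro hk
    have hsub : Set.Iic k ⊆ {k | t < f (e k)} := fun l hl => hk.trans_le (hanti _ _ hl)
    refine lt_of_lt_of_le ?_ (Set.encard_le_encard hsub)
    rw [Set.encard_eq_coe_toFinset_card, Set.toFinset_Iic, Fin.card_Iic]
    exact_mod_cast Nat.lt_succ_self _
  · intro hk
    by_contra hcon
    have hsub : {k | t < f (e k)} ⊆ Set.Iio k := fun l hl => by
      by_contra hlk
      exact hcon (lt_of_lt_of_le hl (hanti _ _ (not_lt.1 hlk)))
    refine absurd (hk.trans_le (Set.encard_le_encard hsub)) ?_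
    rw [Set.encard_eq_coe_toFinset_card, Set.toFinset_Iio, Fin.card_Iio]
    exact lt_irrefl _

/-- The `k`-th largest element of `B` is sent to the `k`-th largest of `A`. The two count
comparisons bound the value in `A` from below and from above. -/
theorem exists_injective_of_encard_le {P Q : Type*} {A : Set P} {B : Set Q} (f : P → ℤ)
    (g : Q → ℤ) (c κ : ℤ) (hA : A.Finite) (hB : B.Finite) (hf : ∀ a ∈ A, c < f a)
    (hg : ∀ b ∈ B, c < g b)
    (h₁ : ∀ t, c ≤ t → {b ∈ B | t < g b}.encard ≤ {a ∈ A | t < f a}.encard)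
    (h₂ : ∀ t, c ≤ t → {a ∈ A | t + κ < f a}.encard ≤ {b ∈ B | t < g b}.encard) :
    ∃ e : B → A, Function.Injective e ∧ (∀ b : B, g b ≤ f (e b) ∧ f (e b) ≤ g b + κ) ∧
      ∀ a : A, c + κ < f a → a ∈ Set.range e := by
  obtain ⟨eA, heA⟩ := exists_equiv_fin_sorted f hA
  obtain ⟨eB, heB⟩ := exists_equiv_fin_sorted g hB
  have hBc : {b ∈ B | c < g b} = B := Set.sep_eq_self_iff_mem_true.2 hg
  have hAc : {a ∈ A | c < f a} = A := Set.sep_eq_self_iff_mem_true.2 hf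
  have hcard : Nat.card B ≤ Nat.card A := by
    have := h₁ c le_rfl
    rw [hBc, hAc] at this
    exact ENat.toNat_le_toNat this hA.encard_lt_top.ne
  have key : ∀ b : B, ∃ k : Fin (Nat.card B), eB k = b := fun b => ⟨eB.symm b, eB.apply_symm_apply b⟩
  refine ⟨fun b => eA (Fin.castLE hcard (eB.symm b)), ?_, ?_, ?_⟩
  · intro b b' hbb
    exact eB.symm.injective (Fin.castLE_injective hcard (eA.injective hbb))
  · intro b
    obtain ⟨k, rfl⟩ := key b
    beta_reduce
    rw [eB.symm_apply_apply]
    have hgk := hg _ (eB k).2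
    constructor
    · have h := (heB k (g (eB k) - 1)).1 (by linarith)
      have h' := (heA (Fin.castLE hcard k) (g (eB k) - 1)).2 (h.trans_le (h₁ _ (by linarith)))
      linarith
    · by_contra hcon
      have h := (heA (Fin.castLE hcard k) (g (eB k) + κ)).1 (not_le.1 hcon)
      have h' := (heB k (g (eB k))).2 (lt_of_lt_of_le h (h₂ _ hgk.le))
      exact lt_irrefl _ h'
  · intro a ha
    obtain ⟨k, rfl⟩ := eA.surjective a
    have h := ((heA k (c + κ)).1 ha).trans_le (h₂ c le_rfl)
    rw [hBc, ← hB.cast_ncard_eq] at h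
    have hk : (k : ℕ) < Nat.card B := by exact_mod_cast h
    refine ⟨eB ⟨k, hk⟩, congrArg eA ?_⟩
    rw [eB.symm_apply_apply]
    rfl

/-- The sorted matching is applied in each fibre of one coordinate, which is thereby preserved
exactly, while the other coordinate moves by at most `κ`. -/
theorem exists_injective_fiberwise {P Q : Type*} (a f : P → ℤ) (b g : Q → ℤ) (c : ℤ → ℤ) (κ : ℤ)
    (hfin : ∀ i, {p | a p = i ∧ c i < f p}.Finite)
    (h₁ : ∀ i t, c i ≤ t → {q | b q = i ∧ t < g q}.encard ≤ {p | a p = i ∧ t < f p}.encard)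
    (h₂ : ∀ i t, c i ≤ t → {p | a p = i ∧ t + κ < f p}.encard ≤ {q | b q = i ∧ t < g q}.encard)
    (hκ : 0 ≤ κ) :
    ∃ e : {q // c (b q) < g q} → P, Function.Injective e ∧
      (∀ q, a (e q) = b q ∧ g q ≤ f (e q) ∧ f (e q) ≤ g q + κ) ∧
      ∀ p, c (a p) + κ < f p → p ∈ Set.range e := by
  have hsepP : ∀ i t, c i ≤ t →
      {p ∈ {p | a p = i ∧ c i < f p} | t < f p} = {p | a p = i ∧ t < f p} := by
    intro i t ht
    ext p
    exact ⟨fun h => ⟨h.1.1, h.2⟩, fun h => ⟨⟨h.1, lt_of_le_of_lt ht h.2⟩, h.2⟩⟩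
  have hsepQ : ∀ i t, c i ≤ t →
      {q ∈ {q | b q = i ∧ c i < g q} | t < g q} = {q | b q = i ∧ t < g q} := by
    intro i t ht
    ext p
    exact ⟨fun h => ⟨h.1.1, h.2⟩, fun h => ⟨⟨h.1, lt_of_le_of_lt ht h.2⟩, h.2⟩⟩
  have H : ∀ i, ∃ e : {q | b q = i ∧ c i < g q} → {p | a p = i ∧ c i < f p},
      Function.Injective e ∧
      (∀ q : {q | b q = i ∧ c i < g q}, g q ≤ f (e q) ∧ f (e q) ≤ g q + κ) ∧
      ∀ p : {p | a p = i ∧ c i < f p}, c i + κ < f p → p ∈ Set.range e := by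
    intro i
    refine exists_injective_of_encard_le f g (c i) κ (hfin i) ?_ (fun p hp => hp.2)
      (fun q hq => hq.2) ?_ ?_
    · exact Set.finite_of_encard_le_coe (k := (hfin i).toFinset.card)
        ((h₁ i (c i) le_rfl).trans_eq (by rw [(hfin i).encard_eq_coe_toFinset_card]))
    · intro t ht
      rw [hsepP i t ht, hsepQ i t ht]
      exact h₁ i t ht
    · intro t ht
      rw [hsepP i (t + κ) (by linarith), hsepQ i t ht]
      exact h₂ i t ht
  choose E hE1 hE2 hE3 using H
  refine ⟨fun q => (E (b q.1) ⟨q.1, rfl, q.2⟩).1, ?_, ?_, ?_⟩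
  · rintro ⟨q, hq⟩ ⟨q', hq'⟩ heq
    have hP := (E (b q) ⟨q, rfl, hq⟩).2.1
    have hP' := (E (b q') ⟨q', rfl, hq'⟩).2.1
    have heq' : (E (b q) ⟨q, rfl, hq⟩).1 = (E (b q') ⟨q', rfl, hq'⟩).1 := heq
    have hb : b q' = b q := by rw [← hP, ← hP', heq']
    have hcongr : ∀ i (hi : b q' = i ∧ c i < g q'),
        (E (b q') ⟨q', rfl, hq'⟩).1 = (E i ⟨q', hi⟩).1 := by
      rintro i ⟨rfl, hi⟩
      rfl
    rw [hcongr (b q) ⟨hb, hb ▸ hq'⟩] at heq'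
    have := hE1 _ (Subtype.ext heq')
    simpa using this
  · rintro ⟨q, hq⟩
    exact ⟨(E (b q) ⟨q, rfl, hq⟩).2.1, hE2 (b q) ⟨q, rfl, hq⟩⟩
  · intro p hp
    obtain ⟨⟨q, hq, hq'⟩, he⟩ := hE3 (a p) ⟨p, rfl, by linarith⟩ hp
    have hcongr : ∀ i (hi : b q = i ∧ c i < g q) (hq0 : c (b q) < g q),
        (E (b q) ⟨q, rfl, hq0⟩).1 = (E i ⟨q, hi⟩).1 := by
      rintro i ⟨rfl, hi⟩ _
      rfl
    refine ⟨⟨q, hq.symm ▸ hq'⟩, ?_⟩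
    exact (hcongr _ ⟨hq, hq'⟩ (hq.symm ▸ hq')).trans (congrArg Subtype.val he)

theorem exists_pequiv_of_rel {P N : Type*} (R : P → N → Prop)
    (h₁ : ∀ x y y', R x y → R x y' → y = y') (h₂ : ∀ x x' y, R x y → R x' y → x = x') :
    ∃ m : P ≃. N, ∀ x y, y ∈ m x ↔ R x y := by
  classical
  have k₁ : ∀ x y, (y ∈ if h : ∃ y, R x y then some h.choose else none) ↔ R x y := by
    intro x y
    split_ifs with h
    · rw [Option.mem_some_iff]
      exact ⟨fun hy => hy ▸ h.choose_spec, fun hy => h₁ _ _ _ h.choose_spec hy⟩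
    · simp only [Option.not_mem_none, false_iff]
      exact fun hy => h ⟨y, hy⟩
  have k₂ : ∀ x y, (x ∈ if h : ∃ x, R x y then some h.choose else none) ↔ R x y := by
    intro x y
    split_ifs with h
    · rw [Option.mem_some_iff]
      exact ⟨fun hy => hy ▸ h.choose_spec, fun hy => h₂ _ _ _ h.choose_spec hy⟩
    · simp only [Option.not_mem_none, false_iff]
      exact fun hy => h ⟨x, hy⟩
  exact ⟨⟨fun x => if h : ∃ y, R x y then some h.choose else none,
    fun y => if h : ∃ x, R x y then some h.choose else none,
    fun x y => (k₂ x y).trans (k₁ x y).symm⟩, k₁⟩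

theorem Set.Finite.of_encard_add_eq_coe {S : Type*} {s : Set S} {a b : ℕ}
    (h : s.encard + a = b) : s.Finite := by
  rw [← Set.encard_ne_top_iff]
  intro hs
  rw [hs] at h
  simp at h

/-- The induced matching through the image of a morphism, for integer valued births and deaths. -/
theorem exists_induced_matching {P Q N : Type*} (iP jP : P → ℤ) (iQ jQ : Q → ℤ) (iN jN : N → ℤ)
    (RP RQ RN : ℤ → ℤ → ℕ) (m : ℕ)
    (hP : ∀ i j, i < j → {z | iP z = i ∧ j < jP z}.encard + RP (i - 1) j = RP i j)
    (hQ : ∀ i j, i < j → {z | iQ z = i ∧ j < jQ z}.encard + RQ (i - 1) j = RQ i j)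
    (hQ' : ∀ i j, i + 2 ≤ j → {z | jQ z = j ∧ iQ z ≤ i}.encard + RQ i j = RQ i (j - 1))
    (hN' : ∀ i j, i + 2 ≤ j → {z | jN z = j ∧ iN z ≤ i}.encard + RN i j = RN i (j - 1))
    (E₁ : ∀ i j, i < j → RQ i j + RP (i - 1) j ≤ RQ (i - 1) j + RP i j)
    (E₂ : ∀ i j, i < j → RP i (j + 2 * m) + RQ (i - 1) j ≤ RP (i - 1) (j + 2 * m) + RQ i j)
    (D₁ : ∀ i j, i < j → RQ i (j - 1) + RN (i + m) (j + m) ≤ RQ i j + RN (i + m) (j + m - 1))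
    (D₂ : ∀ i j, i < j → RN (i - m) (j + m - 1) + RQ i j ≤ RN (i - m) (j + m) + RQ i (j - 1)) :
    ∃ e : P ≃. N, (∀ x y, y ∈ e x → |iP x - iN y| ≤ m ∧ |jP x - jN y| ≤ m) ∧
      (∀ x, e x = none → jP x ≤ iP x + 1 + 2 * m) ∧
      ∀ y, e.symm y = none → jN y ≤ iN y + 1 + 2 * m := by
  have cancel : ∀ {s t : ℕ∞} {a b c d : ℕ}, s + a = b → t + c = d → b + c ≤ a + d → s ≤ t := by
    intro s t a b c d h1 h2 h3
    have hs : s ≠ ⊤ := by rintro rfl; simp at h1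
    have ht : t ≠ ⊤ := by rintro rfl; simp at h2
    lift s to ℕ using hs
    lift t to ℕ using ht
    norm_cast at h1 h2 ⊢
    omega
  -- From `Q` to `P`: births are fixed and deaths grow by at most `2 * m`. The threshold `i + 1`
  -- discards the points next to the diagonal, where the counting identities, which need `i < j`,
  -- say nothing.
  obtain ⟨e, he1, he2, he3⟩ := exists_injective_fiberwise iP jP iQ jQ (fun i => i + 1) (2 * m)
    (fun i => Set.Finite.of_encard_add_eq_coe (hP i (i + 1) (by omega)))
    (fun i t ht => cancel (hQ i t (by omega)) (hP i t (by omega))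
      (by have := E₁ i t (by omega); omega))
    (fun i t ht => cancel (hP i (t + 2 * m) (by omega)) (hQ i t (by omega))
      (by have := E₂ i t (by omega); omega)) (by omega)
  have cN : ∀ j t s i : ℤ, i = m - s - 1 → j + m - i ≥ 2 →
      {p | jN p - m = j ∧ s < m - iN p}.encard + RN i (j + m) = RN i (j + m - 1) := by
    rintro j t s i rfl hi
    rw [← hN' _ _ (by omega)]
    congr 3
    ext p
    omega
  have cQ : ∀ j t i : ℤ, i = - t - 1 → j - i ≥ 2 →
      {p | jQ p = j ∧ t < - iQ p}.encard + RQ i j = RQ i (j - 1) := by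
    rintro j t i rfl hi
    rw [← hQ' _ _ (by omega)]
    congr 3
    ext p
    omega
  -- The dual step from `Q` to `N`: deaths are fixed up to the shift `m`, and births are negated so
  -- that earlier births rank higher. The condition `1 - j < -i` is again `i + 1 < j`, so both
  -- injections have the same domain in `Q`.
  obtain ⟨e', he1', he2', he3'⟩ := exists_injective_fiberwise (fun p => jN p - m)
    (fun p => m - iN p) jQ (fun q => - iQ q) (fun j => 1 - j) (2 * m)
    (fun j => Set.Finite.of_encard_add_eq_coe (cN j 0 (1 - j) _ rfl (by omega)))
    (fun j t ht => cancel (cQ j t (-t - 1) rfl (by omega))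
      (cN j t t (-t - 1 + m) (by omega) (by omega))
      (by have := D₁ (-t - 1) j (by omega); omega))
    (fun j t ht => cancel (cN j t (t + 2 * m) (-t - 1 - m) (by omega) (by omega))
      (cQ j t (-t - 1) rfl (by omega))
      (by have := D₂ (-t - 1) j (by omega); omega)) (by omega)
  -- Two points are matched when they are the images of one point of `Q`. The shift `m` in the
  -- deaths turns the range `[0, 2m]` of displacements into `[-m, m]`.
  obtain ⟨μ, hμ⟩ := exists_pequiv_of_rel
    (fun x y => ∃ (q : Q) (h : iQ q + 1 < jQ q) (h' : 1 - jQ q < - iQ q),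
      e ⟨q, h⟩ = x ∧ e' ⟨q, h'⟩ = y)
    (by
      rintro x y y' ⟨q, h, h', rfl, rfl⟩ ⟨q', k, k', hx, rfl⟩
      have hq := he1 hx
      simp only [Subtype.mk.injEq] at hq
      subst hq
      rfl)
    (by
      rintro x x' y ⟨q, h, h', rfl, rfl⟩ ⟨q', k, k', rfl, hy⟩
      have hq := he1' hy
      simp only [Subtype.mk.injEq] at hq
      subst hq
      rfl)
  refine ⟨μ, ?_, ?_, ?_⟩
  · intro x y hxy
    obtain ⟨q, h, h', rfl, rfl⟩ := (hμ x y).1 hxy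
    have a1 := he2 ⟨q, h⟩
    have a2 := he2' ⟨q, h'⟩
    simp only at a1 a2
    rw [abs_le, abs_le]
    omega
  · intro x hx
    by_contra hcon
    obtain ⟨⟨q, h⟩, hq⟩ := he3 x (by omega)
    have := (hμ x (e' ⟨q, by omega⟩)).2 ⟨q, h, by omega, hq, rfl⟩
    rw [hx] at this
    simp at this
  · intro y hy
    by_contra hcon
    obtain ⟨⟨q, h⟩, hq⟩ := he3' y (by omega)
    have := (hμ (e ⟨q, by omega⟩) y).2 ⟨q, by omega, h, rfl, hq⟩
    rw [← PEquiv.mem_iff_mem, hy] at this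
    simp at this

/-! ### Counting points on a regular grid -/

/-- The nodes of an equidistant grid. -/
def gridNode (θ h : ℝ) (i : ℤ) : ℝ := θ + i * h

/-- The cell `(gridNode (i - 1), gridNode i]` of a grid that contains a real number. -/
def gridCell (θ h x : ℝ) : ℤ := ⌈(x - θ) / h⌉

section Grid

variable {θ h : ℝ}

theorem lt_gridCell (hh : 0 < h) {x : ℝ} {i : ℤ} : i < gridCell θ h x ↔ gridNode θ h i < x := by
  rw [gridCell, Int.lt_ceil, lt_div_iff₀ hh, gridNode, lt_sub_iff_add_lt, add_comm]

theorem gridCell_le (hh : 0 < h) {x : ℝ} {i : ℤ} : gridCell θ h x ≤ i ↔ x ≤ gridNode θ h i := by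
  rw [← not_lt, lt_gridCell hh, not_lt]

theorem gridNode_strictMono (hh : 0 < h) : StrictMono (gridNode θ h) := by
  intro i j hij
  have : (i : ℝ) < j := by exact_mod_cast hij
  unfold gridNode
  nlinarith

theorem abs_sub_le_of_gridCell (hh : 0 < h) {x y : ℝ} {m : ℕ}
    (hxy : |gridCell θ h x - gridCell θ h y| ≤ m) : |x - y| ≤ m * h + h := by
  have hx1 := (gridCell_le (θ := θ) hh (x := x)).1 le_rfl
  have hy1 := (gridCell_le (θ := θ) hh (x := y)).1 le_rfl
  have hx2 := (lt_gridCell (θ := θ) hh (x := x)).1 (sub_one_lt _)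
  have hy2 := (lt_gridCell (θ := θ) hh (x := y)).1 (sub_one_lt _)
  rw [abs_le] at hxy
  have b1 : (-(m : ℝ)) ≤ (gridCell θ h x : ℝ) - gridCell θ h y := by exact_mod_cast hxy.1
  have b2 : (gridCell θ h x : ℝ) - gridCell θ h y ≤ m := by exact_mod_cast hxy.2
  simp only [gridNode, Int.cast_sub, Int.cast_one] at hx1 hx2 hy1 hy2
  rw [abs_le]
  constructor <;> nlinarith

theorem sub_le_of_gridCell (hh : 0 < h) {x y : ℝ} {m : ℕ}
    (hxy : gridCell θ h y ≤ gridCell θ h x + 1 + 2 * m) : y - x ≤ 2 * (m * h + h) := by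
  have hy1 := (gridCell_le (θ := θ) hh (x := y)).1 le_rfl
  have hx2 := (lt_gridCell (θ := θ) hh (x := x)).1 (sub_one_lt _)
  have b1 : (gridCell θ h y : ℝ) ≤ gridCell θ h x + 1 + 2 * m := by exact_mod_cast hxy
  simp only [gridNode, Int.cast_sub, Int.cast_one] at hy1 hx2
  nlinarith

theorem exists_gridNode_lt (hh : 0 < h) (L : ℝ) (i : ℤ) : ∃ j < i, gridNode θ h j < L := by
  refine ⟨min (i - 1) (gridCell θ h L - 1), by omega, ?_⟩
  exact (lt_gridCell hh).1 (by omega)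

theorem exists_le_gridNode (hh : 0 < h) (T : ℝ) (i : ℤ) : ∃ j > i, T ≤ gridNode θ h j := by
  refine ⟨max (i + 1) (gridCell θ h T), by omega, ?_⟩
  exact (gridCell_le hh).1 (by omega)

/-- The rank function vanishes for small births and for large deaths. -/
def HasBoundedSupport (r : ℝ → ℝ → ℕ) : Prop :=
  ∃ L T : ℝ, ∀ a t, a < L ∨ T ≤ t → r a t = 0

variable {r : ℝ → ℝ → ℕ} {P : Type*} {β δ : P → ℝ}

/-- Close the half-infinite box by a grid line `J` beyond the support. The rank terms at `J` vanish,
and no point dies beyond it since it would lie in a box of count zero. Regular grid lines carry no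
points, so half-open cells and open boxes agree. -/
theorem Represents.encard_birth_add (H : Represents r β δ) (hr : RankLike r)
    (hs : HasBoundedSupport r) (hh : 0 < h) (hreg : ∀ i, IsRegular r (gridNode θ h i)) (i j : ℤ)
    (hij : i < j) :
    {z | gridCell θ h (β z) = i ∧ j < gridCell θ h (δ z)}.encard +
      r (gridNode θ h (i - 1)) (gridNode θ h j) = r (gridNode θ h i) (gridNode θ h j) := by
  obtain ⟨L, T, hLT⟩ := hs
  obtain ⟨J, hJ, hTJ⟩ := exists_le_gridNode (θ := θ) hh T j
  have hm := gridNode_strictMono (θ := θ) hh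
  have hc := H.countsBox hr (hreg (i - 1)) (hreg i) (hreg j) (hreg J) (hm (sub_one_lt i)) (hm hij)
    (hm hJ)
  have hset : {z | gridCell θ h (β z) = i ∧ j < gridCell θ h (δ z)} =
      {z | gridNode θ h (i - 1) < β z ∧ β z < gridNode θ h i ∧ gridNode θ h j < δ z ∧
        δ z < gridNode θ h J} := by
    ext z
    simp only [Set.mem_ofPred_eq]
    rw [← lt_gridCell hh (x := β z), ← lt_gridCell hh (x := δ z)]
    have n1 := H.birth_ne hr (hreg i) z
    have hJz : δ z < gridNode θ h J := by
      by_contra hcon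
      have hlt := lt_of_le_of_ne (not_lt.1 hcon) (H.death_ne hr (hreg J) z).symm
      obtain ⟨t, ht1, ht2⟩ := exists_between (max_lt hlt (H.lt z))
      rw [max_lt_iff] at ht1
      obtain ⟨q, hq1, hq2⟩ := exists_between ht1.2
      have := H.boxCount_pos z (sub_one_lt _) hq1 hq2 ht2 (lt_add_one _)
      rw [boxCount, hLT q t (Or.inr (by linarith)), hLT _ (δ z + 1) (Or.inr (by linarith))] at this
      omega
    have e1 : β z < gridNode θ h i ↔ gridCell θ h (β z) ≤ i := by
      rw [gridCell_le hh]
      exact ⟨le_of_lt, fun hle => lt_of_le_of_ne hle n1⟩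
    rw [e1]
    constructor
    · rintro ⟨a1, a2⟩
      exact ⟨by omega, a1.le, a2, hJz⟩
    · rintro ⟨a1, a2, a3, -⟩
      exact ⟨by omega, a3⟩
  rw [hset, hc]
  have z1 := hLT (gridNode θ h i) _ (Or.inr hTJ)
  have z2 := hLT (gridNode θ h (i - 1)) _ (Or.inr hTJ)
  have hmono := hr.mono _ _ _ (hm (sub_one_lt i)).le (hm hij).le
  norm_cast
  rw [boxCount, z1, z2]
  omega

theorem Represents.encard_death_add (H : Represents r β δ) (hr : RankLike r)
    (hs : HasBoundedSupport r) (hh : 0 < h) (hreg : ∀ i, IsRegular r (gridNode θ h i)) (i j : ℤ)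
    (hij : i + 2 ≤ j) :
    {z | gridCell θ h (δ z) = j ∧ gridCell θ h (β z) ≤ i}.encard +
      r (gridNode θ h i) (gridNode θ h j) = r (gridNode θ h i) (gridNode θ h (j - 1)) := by
  obtain ⟨L, T, hLT⟩ := hs
  obtain ⟨I, hI, hLI⟩ := exists_gridNode_lt (θ := θ) hh L i
  have hm := gridNode_strictMono (θ := θ) hh
  have hij' : i < j - 1 := by omega
  have hc := H.countsBox hr (hreg I) (hreg i) (hreg (j - 1)) (hreg j) (hm hI) (hm hij')
    (hm (sub_one_lt j))
  have hset : {z | gridCell θ h (δ z) = j ∧ gridCell θ h (β z) ≤ i} =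
      {z | gridNode θ h I < β z ∧ β z < gridNode θ h i ∧ gridNode θ h (j - 1) < δ z ∧
        δ z < gridNode θ h j} := by
    ext z
    simp only [Set.mem_ofPred_eq]
    rw [gridCell_le hh, ← lt_gridCell hh (x := δ z)]
    have n1 := H.birth_ne hr (hreg i) z
    have n2 := H.death_ne hr (hreg j) z
    have hIz : gridNode θ h I < β z := by
      by_contra hcon
      have hlt := lt_of_le_of_ne (not_lt.1 hcon) (H.birth_ne hr (hreg I) z)
      obtain ⟨q, hq1, hq2⟩ := exists_between (lt_min hlt (H.lt z))
      rw [lt_min_iff] at hq2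
      obtain ⟨t, ht1, ht2⟩ := exists_between hq2.2
      have := H.boxCount_pos z (sub_one_lt _) hq1 ht1 ht2 (lt_add_one _)
      rw [boxCount, hLT q t (Or.inl (by linarith)),
        hLT (β z - 1) (δ z + 1) (Or.inl (by linarith))] at this
      omega
    have e1 : δ z < gridNode θ h j ↔ gridCell θ h (δ z) ≤ j := by
      rw [gridCell_le hh]
      exact ⟨le_of_lt, fun hle => lt_of_le_of_ne hle n2⟩
    rw [e1]
    constructor
    · rintro ⟨a1, a2⟩
      exact ⟨hIz, lt_of_le_of_ne a2 n1, by omega, by omega⟩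
    · rintro ⟨-, a2, a3, a4⟩
      exact ⟨by omega, a2.le⟩
  rw [hset, hc]
  have z1 := hLT _ (gridNode θ h j) (Or.inl hLI)
  have z2 := hLT _ (gridNode θ h (j - 1)) (Or.inl hLI)
  have hanti := hr.anti _ _ _ (hm hij').le (hm (sub_one_lt j)).le
  norm_cast
  rw [boxCount, z1, z2]
  omega

end Grid

theorem _root_.Function.Injective.encard_range_fin {S : Type*} {n : ℕ} {f : Fin n → S}
    (hf : Function.Injective f) : (Set.range f).encard = n := by
  rw [← Set.image_univ, hf.encard_image, Set.encard_univ, ENat.card_eq_coe_fintype_card,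
    Fintype.card_fin]

/-- The points given by the multiplicities of a rank function. -/
def RankPoints (r : ℝ → ℝ → ℕ) : Type :=
  Σ p : {p : ℝ × ℝ // p.1 < p.2}, Fin (multiplicity r p.1.1 (p.1.2 : ℝ))

theorem represents_rankPoints (r : ℝ → ℝ → ℕ) :
    Represents r (fun z : RankPoints r => z.1.1.1) (fun z : RankPoints r => z.1.1.2) where
  lt z := z.1.2
  encard_fiber x y hxy := by
    have hset : {z : RankPoints r | z.1.1.1 = x ∧ z.1.1.2 = y} =
        Set.range (fun k : Fin (multiplicity r x (y : ℝ)) => (⟨⟨(x, y), hxy⟩, k⟩ : RankPoints r)) := by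
      ext z
      constructor
      · obtain ⟨⟨⟨x', y'⟩, hz⟩, k⟩ := z
        rintro ⟨h1, h2⟩
        simp only at h1 h2
        subst h1 h2
        exact ⟨k, rfl⟩
      · rintro ⟨k, rfl⟩
        exact ⟨rfl, rfl⟩
    have hinj : Function.Injective
        (fun k : Fin (multiplicity r x (y : ℝ)) => (⟨⟨(x, y), hxy⟩, k⟩ : RankPoints r)) :=
      fun k l hkl => eq_of_heq (Sigma.mk.inj hkl).2
    rw [hset]
    exact hinj.encard_range_fin

/-- Matching of the points of two rank functions that are related through the rank function of the
image of an interleaving morphism. -/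
theorem exists_matching_of_rank {P N : Type*} {rM rN rQ : ℝ → ℝ → ℕ} {βM δM : P → ℝ}
    {βN δN : N → ℝ} (HM : Represents rM βM δM) (HN : Represents rN βN δN) (hM : RankLike rM)
    (hN : RankLike rN) (hQ : RankLike rQ) (sM : HasBoundedSupport rM) (sN : HasBoundedSupport rN)
    (sQ : HasBoundedSupport rQ) {h ε : ℝ} {m : ℕ} (hh : 0 < h) (hε : ε = m * h)
    (E₁ : ∀ a' a b, a' ≤ a → a ≤ b → rQ a b + rM a' b ≤ rQ a' b + rM a b)
    (E₂ : ∀ a' a b, a' ≤ a → a ≤ b →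
      rM a (b + 2 * ε) + rQ a' b ≤ rM a' (b + 2 * ε) + rQ a b)
    (D₁ : ∀ a b b', a ≤ b → b ≤ b' →
      rQ a b + rN (a + ε) (b' + ε) ≤ rQ a b' + rN (a + ε) (b + ε))
    (D₂ : ∀ a b b', a ≤ b → b ≤ b' →
      rN (a - ε) (b + ε) + rQ a b' ≤ rN (a - ε) (b' + ε) + rQ a b) :
    ∃ e : P ≃. N,
      (∀ x y, y ∈ e x → |βM x - βN y| ≤ ε + h ∧ |δM x - δN y| ≤ ε + h) ∧
      (∀ x, e x = none → δM x - βM x ≤ 2 * (ε + h)) ∧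
      ∀ y, e.symm y = none → δN y - βN y ≤ 2 * (ε + h) := by
  -- Only countably many offsets put some grid node on a value that is not regular for one of the
  -- three rank functions; any other offset `θ` works.
  have hbad : (⋃ i : ℤ, (fun x : ℝ => x - i * h) '' ({x | ¬ IsRegular rM x} ∪
      ({x | ¬ IsRegular rN x} ∪ {x | ¬ IsRegular rQ x}))).Countable :=
    Set.countable_iUnion fun i => (hM.countable_not_isRegular.union
      (hN.countable_not_isRegular.union hQ.countable_not_isRegular)).image _
  obtain ⟨θ, hθ⟩ := (hbad.dense_compl ℝ).nonempty
  have hreg : ∀ i, IsRegular rM (gridNode θ h i) ∧ IsRegular rN (gridNode θ h i) ∧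
      IsRegular rQ (gridNode θ h i) := by
    intro i
    by_contra hcon
    refine hθ (Set.mem_iUnion.2 ⟨i, gridNode θ h i, ?_, by simp [gridNode]⟩)
    simp only [Set.mem_union, Set.mem_ofPred_eq]
    tauto
  have hm := (gridNode_strictMono (θ := θ) hh).monotone
  have n1 : ∀ (j : ℤ), gridNode θ h (j + 2 * m) = gridNode θ h j + 2 * ε := by
    intro j
    simp only [gridNode, hε]
    push_cast
    ring
  have n2 : ∀ (j : ℤ), gridNode θ h (j + m) = gridNode θ h j + ε := by
    intro j
    simp only [gridNode, hε]
    push_cast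
    ring
  have n3 : ∀ (j : ℤ), gridNode θ h (j - m) = gridNode θ h j - ε := by
    intro j
    simp only [gridNode, hε]
    push_cast
    ring
  have n4 : ∀ (j : ℤ), gridNode θ h (j + m - 1) = gridNode θ h (j - 1) + ε := by
    intro j
    simp only [gridNode, hε]
    push_cast
    ring
  have HQ := represents_rankPoints rQ
  have R1 := fun i => (hreg i).1
  have R2 := fun i => (hreg i).2.1
  have R3 := fun i => (hreg i).2.2
  obtain ⟨e, he1, he2, he3⟩ := exists_induced_matching (fun z => gridCell θ h (βM z))
    (fun z => gridCell θ h (δM z)) (fun z : RankPoints rQ => gridCell θ h z.1.1.1)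
    (fun z => gridCell θ h z.1.1.2) (fun z => gridCell θ h (βN z)) (fun z => gridCell θ h (δN z))
    (fun i j => rM (gridNode θ h i) (gridNode θ h j))
    (fun i j => rQ (gridNode θ h i) (gridNode θ h j))
    (fun i j => rN (gridNode θ h i) (gridNode θ h j)) m
    (HM.encard_birth_add hM sM hh R1) (HQ.encard_birth_add hQ sQ hh R3)
    (HQ.encard_death_add hQ sQ hh R3) (HN.encard_death_add hN sN hh R2)
    (fun i j hij => E₁ _ _ _ (hm (by omega)) (hm hij.le))
    (fun i j hij => by
      simp only [n1]
      exact E₂ _ _ _ (hm (by omega)) (hm hij.le))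
    (fun i j hij => by
      simp only [n2, n4]
      exact D₁ _ _ _ (hm (by omega)) (hm (by omega)))
    (fun i j hij => by
      simp only [n2, n3, n4]
      exact D₂ _ _ _ (hm (by omega)) (hm (by omega)))
  refine ⟨e, fun x y hxy => ?_, fun x hx => ?_, fun y hy => ?_⟩
  · rw [hε]
    exact ⟨abs_sub_le_of_gridCell hh (he1 x y hxy).1, abs_sub_le_of_gridCell hh (he1 x y hxy).2⟩
  · rw [hε]
    exact sub_le_of_gridCell hh (he2 x hx)
  · rw [hε]
    exact sub_le_of_gridCell hh (he3 y hy)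

/-! ### Truncation of rank functions -/

/-- The rank function of the module that is set to zero from `T` on. -/
def truncRank (r : ℝ → ℝ → ℕ) (T a b : ℝ) : ℕ :=
  if b < T then r a b else 0

theorem truncRank_of_lt {r : ℝ → ℝ → ℕ} {T a b : ℝ} (h : b < T) : truncRank r T a b = r a b :=
  if_pos h

theorem truncRank_of_le {r : ℝ → ℝ → ℕ} {T a b : ℝ} (h : T ≤ b) : truncRank r T a b = 0 :=
  if_neg (not_lt.2 h)

theorem RankLike.truncate {r : ℝ → ℝ → ℕ} (hr : RankLike r) (T : ℝ) :
    RankLike (truncRank r T) where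
  mono p q t h₁ h₂ := by
    have := hr.mono p q t h₁ h₂
    unfold truncRank
    split_ifs <;> omega
  anti q t t' h₁ h₂ := by
    have := hr.anti q t t' h₁ h₂
    unfold truncRank
    split_ifs
    · exact this
    · linarith
    · omega
    · omega
  box p q t t' h₁ h₂ h₃ := by
    have := hr.box p q t t' h₁ h₂ h₃
    have := hr.mono p q t h₁ h₂
    unfold truncRank
    split_ifs
    · omega
    · omega
    · linarith
    · omega

/-- The rank function is constant from `T` on. -/
structure EventuallyConstant (r : ℝ → ℝ → ℕ) (T : ℝ) : Prop where
  death : ∀ a t t', T ≤ t → t ≤ t' → a ≤ t → r a t = r a t'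
  birth : ∀ a a' t, T ≤ a → a ≤ a' → a' ≤ t → r a t = r a' t

theorem EventuallyConstant.multiplicity_eq_zero {r : ℝ → ℝ → ℕ} {T b d : ℝ}
    (h : EventuallyConstant r T) (hbd : b < d) (hd : T < d) : multiplicity r b (d : ℝ) = 0 := by
  obtain ⟨t, ht1, ht2⟩ := exists_between (max_lt hbd hd)
  rw [max_lt_iff] at ht1
  obtain ⟨q, hq1, hq2⟩ := exists_between ht1.1
  have hle := multiplicity_le_boxCount (r := r) (sub_one_lt b) hq1 hq2 ht2 (lt_add_one d)
  rw [boxCount, h.death q t (d + 1) ht1.2.le (by linarith) hq2.le,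
    h.death (b - 1) t (d + 1) ht1.2.le (by linarith) (by linarith)] at hle
  omega

theorem EventuallyConstant.multiplicity_top_eq_zero {r : ℝ → ℝ → ℕ} {T b : ℝ}
    (h : EventuallyConstant r T) (hb : T < b) : multiplicity r b ⊤ = 0 := by
  obtain ⟨p, hp1, hp2⟩ := exists_between hb
  have hle : multiplicity r b ⊤ ≤ r (b + 1) (b + 2) - r p (b + 2) :=
    Nat.sInf_le ⟨p, b + 1, b + 2, hp2, by linarith, by linarith, rfl⟩
  rw [h.birth p (b + 1) (b + 2) hp1.le (by linarith) (by linarith)] at hle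
  omega

theorem RankLike.multiplicity_truncRank {r : ℝ → ℝ → ℕ} (hr : RankLike r) {T b d : ℝ}
    (hbd : b < d) (hd : d < T) :
    multiplicity (truncRank r T) b (d : ℝ) = multiplicity r b (d : ℝ) := by
  obtain ⟨e, he1, he2⟩ := exists_between hd
  refine (hr.truncate T).multiplicity_congr hr hbd (sub_one_lt b) (lt_add_one b) (sub_one_lt d)
    he1 ?_
  intro x y _ _ _ hy
  exact truncRank_of_lt (hy.trans_lt he2)

/-- Truncated ranks vanish on the far side of `T'`, so a box straddling `T'` counts `r q t - r p t`,
as does a rectangle reaching to infinity. Constancy after `T` allows `t` to be moved between the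
two. -/
theorem RankLike.multiplicity_truncRank_self {r : ℝ → ℝ → ℕ} (hr : RankLike r) {T T' b : ℝ}
    (h : EventuallyConstant r T) (hb : b < T') (hT : T < T') :
    multiplicity (truncRank r T') b (T' : ℝ) = multiplicity r b ⊤ := by
  apply le_antisymm
  · have hne : {n | ∃ p q t : ℝ, p < b ∧ b < q ∧ q < t ∧ n = r q t - r p t}.Nonempty :=
      ⟨_, b - 1, b + 1, b + 2, by linarith, by linarith, by linarith, rfl⟩
    obtain ⟨p, q, t, h1, h2, h3, h4⟩ := Nat.sInf_mem hne
    have h4' : multiplicity r b ⊤ = r q t - r p t := h4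
    obtain ⟨t₁, ht1, ht2⟩ := exists_between (max_lt hb hT)
    rw [max_lt_iff] at ht1
    obtain ⟨q', hq1, hq2⟩ := exists_between (lt_min h2 ht1.1)
    rw [lt_min_iff] at hq2
    refine (multiplicity_le_boxCount h1 hq1 hq2.2 ht2 (lt_add_one T')).trans ?_
    rw [boxCount, truncRank_of_lt ht2, truncRank_of_lt ht2, truncRank_of_le (by linarith),
      truncRank_of_le (by linarith), h4']
    have e1 : r q' t₁ = r q' (max t t₁) :=
      h.death _ _ _ ht1.2.le (le_max_right _ _) hq2.2.le
    have e2 : r p t₁ = r p (max t t₁) :=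
      h.death _ _ _ ht1.2.le (le_max_right _ _) (by linarith)
    have e3 := hr.box p q t (max t t₁) (by linarith) h3.le (le_max_left _ _)
    have e5 := hr.mono q' q (max t t₁) hq2.1.le (h3.le.trans (le_max_left _ _))
    have e6 : r q (max t t₁) - r p (max t t₁) ≤ r q t - r p t := by omega
    omega
  · obtain ⟨p, q, t, t', -, h1, h2, -, h3, -, h4, h5, -, h6⟩ :=
      (hr.truncate T').exists_boxCount_eq hb (sub_one_lt b) (lt_add_one b) (sub_one_lt T')
        (lt_add_one T')
    rw [boxCount, truncRank_of_lt h4, truncRank_of_lt h4, truncRank_of_le h5.le,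
      truncRank_of_le h5.le] at h6
    rw [← h6]
    exact Nat.sInf_le ⟨p, q, t, h1, h2, h3, by omega⟩

/-- Death times, where `∞` is replaced by `T`. -/
def truncDeath (T : ℝ) : WithTop ℝ → ℝ
  | none => T
  | some d => d

/-- The diagram with rank function `r`. -/
def rankDiagram (r : ℝ → ℝ → ℕ) : Diagram :=
  fun p => multiplicity r p.1.1 p.1.2

section

variable {r : ℝ → ℝ → ℕ} {T : ℝ}

theorem EventuallyConstant.birth_le (h : EventuallyConstant r T) {b : ℝ} {hb}
    (k : Fin (rankDiagram r ⟨(b, none), hb⟩)) : b ≤ T := by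
  by_contra hcon
  have h0 : rankDiagram r ⟨(b, none), hb⟩ = 0 := h.multiplicity_top_eq_zero (not_le.1 hcon)
  exact absurd k.2 (by omega)

theorem EventuallyConstant.death_le (h : EventuallyConstant r T) {b d : ℝ} {hb}
    (k : Fin (rankDiagram r ⟨(b, some d), hb⟩)) : d ≤ T := by
  by_contra hcon
  have hbd : b < d := WithTop.coe_lt_coe.1 hb
  have h0 : rankDiagram r ⟨(b, some d), hb⟩ = 0 := h.multiplicity_eq_zero hbd (not_le.1 hcon)
  exact absurd k.2 (by omega)

/-- Below `T'` truncation changes no multiplicity; at `T'` sit exactly the points of infinite death,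
because finite deaths are at most `T < T'`; above `T'` nothing is left. -/
theorem RankLike.represents_truncRank (hr : RankLike r) (h : EventuallyConstant r T) {T' : ℝ}
    (hT : T < T') :
    Represents (truncRank r T') (fun z : (rankDiagram r).Points => z.1.1.1)
      (fun z => truncDeath T' z.1.1.2) where
  lt := by
    rintro ⟨⟨⟨b, _ | d⟩, hb⟩, k⟩
    · exact (h.birth_le k).trans_lt hT
    · exact WithTop.coe_lt_coe.1 hb
  encard_fiber x y hxy := by
    rcases lt_trichotomy y T' with hy | rfl | hy
    · have hset : {z : (rankDiagram r).Points | z.1.1.1 = x ∧ truncDeath T' z.1.1.2 = y} =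
          Set.range (fun k : Fin (multiplicity r x (y : ℝ)) =>
            (⟨⟨(x, (y : ℝ)), WithTop.coe_lt_coe.2 hxy⟩, k⟩ : (rankDiagram r).Points)) := by
        ext z
        constructor
        · obtain ⟨⟨⟨b, _ | d⟩, hb⟩, k⟩ := z
          · rintro ⟨-, h2⟩
            exact absurd h2 hy.ne'
          · rintro ⟨h1, h2⟩
            change b = x at h1
            change d = y at h2
            subst h1 h2
            exact ⟨k, rfl⟩
        · rintro ⟨k, rfl⟩
          exact ⟨rfl, rfl⟩
      rw [hr.multiplicity_truncRank hxy hy, hset]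
      exact Function.Injective.encard_range_fin fun k l hkl => eq_of_heq (Sigma.mk.inj hkl).2
    · have hset : {z : (rankDiagram r).Points | z.1.1.1 = x ∧ truncDeath y z.1.1.2 = y} =
          Set.range (fun k : Fin (multiplicity r x ⊤) =>
            (⟨⟨(x, ⊤), WithTop.coe_lt_top x⟩, k⟩ : (rankDiagram r).Points)) := by
        ext z
        constructor
        · obtain ⟨⟨⟨b, _ | d⟩, hb⟩, k⟩ := z
          · rintro ⟨h1, -⟩
            change b = x at h1
            subst h1
            exact ⟨k, rfl⟩
          · rintro ⟨h1, h2⟩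
            change d = y at h2
            exact absurd (h.death_le k) (by linarith)
        · rintro ⟨k, rfl⟩
          exact ⟨rfl, rfl⟩
      rw [hr.multiplicity_truncRank_self h hxy hT, hset]
      exact Function.Injective.encard_range_fin fun k l hkl => eq_of_heq (Sigma.mk.inj hkl).2
    · have h0 : multiplicity (truncRank r T') x (y : ℝ) = 0 := by
        obtain ⟨t, ht1, ht2⟩ := exists_between (max_lt hxy hy)
        rw [max_lt_iff] at ht1
        obtain ⟨q, hq1, hq2⟩ := exists_between ht1.1
        have hle := multiplicity_le_boxCount (r := truncRank r T')
          (sub_one_lt x) hq1 hq2 ht2 (lt_add_one y)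
        rw [boxCount, truncRank_of_le ht1.2.le, truncRank_of_le (by linarith)] at hle
        omega
      rw [h0, Nat.cast_zero, Set.encard_eq_zero, Set.eq_empty_iff_forall_notMem]
      rintro ⟨⟨⟨b, _ | d⟩, hb⟩, k⟩ ⟨-, h2⟩
      · change T' = y at h2
        linarith
      · change d = y at h2
        have := h.death_le k
        linarith

end

/-! ### Algebraic stability -/

/-- The dimension that `f` loses on a subspace is that of its intersection with the kernel, which
grows with the subspace. The box inequality for ranks and the four comparisons required of an
interleaving are all instances of this. -/
theorem finrank_map_add_le {𝕜 V W : Type*} [Field 𝕜] [AddCommGroup V] [Module 𝕜 V]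
    [FiniteDimensional 𝕜 V] [AddCommGroup W] [Module 𝕜 W] (f : V →ₗ[𝕜] W) {A' A : Submodule 𝕜 V}
    (h : A' ≤ A) :
    Module.finrank 𝕜 (A.map f) + Module.finrank 𝕜 A' ≤
      Module.finrank 𝕜 (A'.map f) + Module.finrank 𝕜 A := by
  have key : ∀ B : Submodule 𝕜 V, Module.finrank 𝕜 (B.map f) +
      Module.finrank 𝕜 (B ⊓ LinearMap.ker f : Submodule 𝕜 V) = Module.finrank 𝕜 B := by
    intro B
    have h1 := LinearMap.finrank_range_add_finrank_ker (f.domRestrict B)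
    rw [LinearMap.range_domRestrict, LinearMap.ker_domRestrict,
      ← Submodule.finrank_map_subtype_eq, Submodule.map_comap_subtype] at h1
    exact h1
  have h1 := key A
  have h2 := key A'
  have h3 := Submodule.finrank_mono (inf_le_inf_right (LinearMap.ker f) h)
  omega

section Algebraic

variable {𝕜 : Type w} [Field 𝕜]

/-- The image of `M_a → M_b`, where `M` is extended by zero below its resolution. -/
def PersistenceModule.im (M : PersistenceModule.{v₁} 𝕜) (a b : ℝ) : Submodule 𝕜 (M.space b) :=
  open Classical in
  if h : M.res ≤ a ∧ a ≤ b then LinearMap.range (M.map a b h.1 h.2) else ⊥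

theorem PersistenceModule.im_eq_range (M : PersistenceModule.{v₁} 𝕜) {a b : ℝ} (h : M.res ≤ a)
    (h' : a ≤ b) : M.im a b = LinearMap.range (M.map a b h h') :=
  dif_pos ⟨h, h'⟩

theorem PersistenceModule.im_of_lt (M : PersistenceModule.{v₁} 𝕜) {a : ℝ} (b : ℝ)
    (h : a < M.res) : M.im a b = ⊥ :=
  dif_neg fun h' => absurd h'.1 (not_le.2 h)

theorem PersistenceModule.rank_eq (M : PersistenceModule.{v₁} 𝕜) (a b : ℝ) :
    M.rank a b = Module.finrank 𝕜 (M.im a b) := by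
  by_cases h : M.res ≤ a ∧ a ≤ b
  · rw [PersistenceModule.rank, PersistenceModule.im, dif_pos h, dif_pos h]
  · rw [PersistenceModule.rank, PersistenceModule.im, dif_neg h, dif_neg h, finrank_bot]

theorem PersistenceModule.im_mono (M : PersistenceModule.{v₁} 𝕜) {a' a b : ℝ} (h : a' ≤ a)
    (h' : a ≤ b) : M.im a' b ≤ M.im a b := by
  rcases lt_or_ge a' M.res with h0 | h0
  · rw [M.im_of_lt _ h0]
    exact bot_le
  · rw [M.im_eq_range h0 (h.trans h'), M.im_eq_range (h0.trans h) h']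
    rintro _ ⟨x, rfl⟩
    exact ⟨M.map a' a h0 h x, M.map_comp _ _ _ _ _ _ x⟩

theorem PersistenceModule.map_im (M : PersistenceModule.{v₁} 𝕜) {a b b' : ℝ} (hb : M.res ≤ b)
    (h : a ≤ b) (h' : b ≤ b') : (M.im a b).map (M.map b b' hb h') = M.im a b' := by
  rcases lt_or_ge a M.res with h0 | h0
  · rw [M.im_of_lt _ h0, M.im_of_lt _ h0, Submodule.map_bot]
  · rw [M.im_eq_range h0 h, M.im_eq_range h0 (h.trans h'), ← LinearMap.range_comp]
    congr 1
    ext x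
    exact M.map_comp _ _ _ _ _ _ x

theorem PersistenceModule.rankLike (M : PersistenceModule.{v₁} 𝕜) (hM : M.IsPointwiseFinite) :
    RankLike M.rank := by
  have h0 : ∀ a b, a < M.res → M.rank a b = 0 := fun a b h => by
    rw [M.rank_eq, M.im_of_lt _ h, finrank_bot]
  have mono : ∀ p q t, p ≤ q → q ≤ t → M.rank p t ≤ M.rank q t := by
    intro p q t h h'
    rcases lt_or_ge q M.res with hq | hq
    · rw [h0 p t (h.trans_lt hq)]
      exact Nat.zero_le _
    have := hM t (hq.trans h')
    rw [M.rank_eq, M.rank_eq]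
    exact Submodule.finrank_mono (M.im_mono h h')
  have box : ∀ p q t t', p ≤ q → q ≤ t → t ≤ t' →
      M.rank p t + M.rank q t' ≤ M.rank q t + M.rank p t' := by
    intro p q t t' h₁ h₂ h₃
    rcases lt_or_ge q M.res with hq | hq
    · rw [h0 p t (h₁.trans_lt hq), h0 q t' hq]
      exact Nat.zero_le _
    have := hM t (hq.trans h₂)
    rw [M.rank_eq, M.rank_eq, M.rank_eq, M.rank_eq,
      ← M.map_im (a := q) (hq.trans h₂) h₂ h₃, ← M.map_im (a := p) (hq.trans h₂) (h₁.trans h₂) h₃]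
    have := finrank_map_add_le (M.map t t' (hq.trans h₂) h₃) (M.im_mono h₁ h₂)
    omega
  refine ⟨mono, fun q t t' h h' => ?_, box⟩
  -- Monotonicity in the death variable is the box inequality with left side below the resolution,
  -- where the rank is zero.
  have h1 := box (min q M.res - 1) q t t' (by linarith [min_le_left q M.res]) h h'
  have h2 : min q M.res - 1 < M.res := by linarith [min_le_right q M.res]
  rw [h0 _ t h2, h0 (min q M.res - 1) t' h2] at h1
  omega

/-- An `ε`-interleaving of two persistence modules with the same resolution, by morphisms
`M_a → N_b` and `N_a → M_b` for `a + ε ≤ b`. -/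
structure PersistenceModule.Interleaving (ε : ℝ) (M : PersistenceModule.{v₁} 𝕜)
    (N : PersistenceModule.{v₂} 𝕜) where
  nonneg : 0 ≤ ε
  res_eq : N.res = M.res
  φ : ∀ a b, M.res ≤ a → a + ε ≤ b → M.space a →ₗ[𝕜] N.space b
  ψ : ∀ a b, M.res ≤ a → a + ε ≤ b → N.space a →ₗ[𝕜] M.space b
  map_φ : ∀ a b b' h (h' : a + ε ≤ b) (hb : N.res ≤ b) (h'' : b ≤ b') x,
    N.map b b' hb h'' (φ a b h h' x) = φ a b' h (h'.trans h'') x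
  φ_map : ∀ a a' b h (h' : a ≤ a') (h'' : a' + ε ≤ b) h₁ h₂ x,
    φ a' b h₁ h'' (M.map a a' h h' x) = φ a b h h₂ x
  ψ_φ : ∀ a b c h h' h₁ h₂ h₃ x, ψ b c h₁ h₂ (φ a b h h' x) = M.map a c h h₃ x
  φ_ψ : ∀ a b c h h' h₁ h₂ h₃ h₄ x, φ b c h₁ h₂ (ψ a b h h' x) = N.map a c h₃ h₄ x

namespace PersistenceModule.Interleaving

variable {M : PersistenceModule.{v₁} 𝕜} {N : PersistenceModule.{v₂} 𝕜} {ε : ℝ}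
  (I : M.Interleaving ε N)

/-- The image of `M_a → N_{b + ε}`. -/
def im (a b : ℝ) : Submodule 𝕜 (N.space (b + ε)) :=
  open Classical in
  if h : M.res ≤ a ∧ a + ε ≤ b + ε then LinearMap.range (I.φ a (b + ε) h.1 h.2) else ⊥

/-- The rank of `M_a → N_{b + ε}`. -/
def rank (a b : ℝ) : ℕ := Module.finrank 𝕜 (I.im a b)

theorem im_eq_range {a b : ℝ} (h : M.res ≤ a) (h' : a + ε ≤ b + ε) :
    I.im a b = LinearMap.range (I.φ a (b + ε) h h') :=
  dif_pos ⟨h, h'⟩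

theorem im_of_lt {a : ℝ} (b : ℝ) (h : a < M.res) : I.im a b = ⊥ :=
  dif_neg fun h' => absurd h'.1 (not_le.2 h)

theorem map_φ_im {a b : ℝ} (hb : M.res ≤ b) (h : a ≤ b) :
    (M.im a b).map (I.φ b (b + ε) hb le_rfl) = I.im a b := by
  rcases lt_or_ge a M.res with h0 | h0
  · rw [M.im_of_lt _ h0, I.im_of_lt _ h0, Submodule.map_bot]
  · rw [M.im_eq_range h0 h, I.im_eq_range h0 (by linarith), ← LinearMap.range_comp]
    congr 1
    ext x
    exact I.φ_map _ _ _ _ _ _ _ _ x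

theorem map_ψ_im {a b : ℝ} (hb : M.res ≤ b) (h : a ≤ b) :
    (I.im a b).map (I.ψ (b + ε) (b + 2 * ε) (hb.trans (by linarith [I.nonneg])) (by linarith)) =
      M.im a (b + 2 * ε) := by
  have := I.nonneg
  rcases lt_or_ge a M.res with h0 | h0
  · rw [M.im_of_lt _ h0, I.im_of_lt _ h0, Submodule.map_bot]
  · rw [M.im_eq_range h0 (by linarith), I.im_eq_range h0 (by linarith), ← LinearMap.range_comp]
    congr 1
    ext x
    exact I.ψ_φ _ _ _ _ _ _ _ _ x

theorem map_im {a b b' : ℝ} (hb : N.res ≤ b + ε) (h : a ≤ b) (h' : b + ε ≤ b' + ε) :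
    (I.im a b).map (N.map (b + ε) (b' + ε) hb h') = I.im a b' := by
  rcases lt_or_ge a M.res with h0 | h0
  · rw [I.im_of_lt _ h0, I.im_of_lt _ h0, Submodule.map_bot]
  · rw [I.im_eq_range h0 (by linarith), I.im_eq_range h0 (by linarith), ← LinearMap.range_comp]
    congr 1
    ext x
    exact I.map_φ _ _ _ _ _ _ _ x

theorem im_mono {a' a b : ℝ} (h : a' ≤ a) (h' : a ≤ b) : I.im a' b ≤ I.im a b := by
  rcases lt_or_ge a' M.res with h0 | h0
  · rw [I.im_of_lt _ h0]
    exact bot_le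
  · rw [I.im_eq_range h0 (by linarith), I.im_eq_range (h0.trans h) (by linarith)]
    rintro _ ⟨x, rfl⟩
    exact ⟨M.map a' a h0 h x, I.φ_map _ _ _ _ _ _ _ _ x⟩

theorem im_le {a b : ℝ} (h : a ≤ b) : I.im a b ≤ N.im (a + ε) (b + ε) := by
  have := I.nonneg
  rcases lt_or_ge a M.res with h0 | h0
  · rw [I.im_of_lt _ h0]
    exact bot_le
  · have hN : N.res ≤ a + ε := by linarith [I.res_eq]
    rw [I.im_eq_range h0 (by linarith), N.im_eq_range hN (by linarith)]
    rintro _ ⟨x, rfl⟩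
    exact ⟨I.φ a (a + ε) h0 le_rfl x, I.map_φ _ _ _ _ _ _ _ x⟩

theorem le_im {a b : ℝ} (h : a ≤ b) : N.im (a - ε) (b + ε) ≤ I.im a b := by
  have := I.nonneg
  rcases lt_or_ge (a - ε) M.res with h0 | h0
  · rw [N.im_of_lt _ (by linarith [I.res_eq])]
    exact bot_le
  · have hN : N.res ≤ a - ε := by linarith [I.res_eq]
    rw [I.im_eq_range (by linarith) (by linarith), N.im_eq_range hN (by linarith)]
    rintro _ ⟨x, rfl⟩
    exact ⟨I.ψ (a - ε) a h0 (by linarith) x, I.φ_ψ _ _ _ _ _ _ _ _ _ x⟩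



theorem finiteDimensional_right (I : M.Interleaving ε N) (hN : N.IsPointwiseFinite) {b : ℝ} (h : M.res ≤ b) : FiniteDimensional 𝕜 (N.space (b + ε)) :=
  hN _ (by linarith [I.nonneg, I.res_eq])


theorem rank_of_lt {a : ℝ} (b : ℝ) (h : a < M.res) : I.rank a b = 0 := by
  rw [rank, I.im_of_lt _ h, finrank_bot]

end PersistenceModule.Interleaving

end Algebraic

/-! ### Rank inequalities for the image of an interleaving morphism -/

section Algebraic

variable {𝕜 : Type w} [Field 𝕜]

namespace PersistenceModule.Interleaving

variable {M : PersistenceModule.{v₁} 𝕜} {N : PersistenceModule.{v₂} 𝕜} {ε : ℝ}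
  (I : M.Interleaving ε N)

theorem module_rank_of_lt (M : PersistenceModule.{v₁} 𝕜) {a : ℝ} (b : ℝ) (h : a < M.res) :
    M.rank a b = 0 := by
  rw [M.rank_eq, M.im_of_lt _ h, finrank_bot]

theorem rank_mono (hN : N.IsPointwiseFinite) {a' a b : ℝ} (h : a' ≤ a) (h' : a ≤ b) :
    I.rank a' b ≤ I.rank a b := by
  rcases lt_or_ge a M.res with ha | ha
  · rw [I.rank_of_lt b (h.trans_lt ha)]
    exact Nat.zero_le _
  have := finiteDimensional_right I hN (ha.trans h')
  exact Submodule.finrank_mono (I.im_mono h h')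

theorem rankLike (hN : N.IsPointwiseFinite) : RankLike I.rank := by
  have box : ∀ p q t t', p ≤ q → q ≤ t → t ≤ t' →
      I.rank p t + I.rank q t' ≤ I.rank q t + I.rank p t' := by
    intro p q t t' h₁ h₂ h₃
    rcases lt_or_ge q M.res with hq | hq
    · rw [I.rank_of_lt t (h₁.trans_lt hq), I.rank_of_lt t' hq]
      exact Nat.zero_le _
    have := finiteDimensional_right I hN (hq.trans h₂)
    have ht : N.res ≤ t + ε := by linarith [I.nonneg, I.res_eq]
    unfold rank
    rw [← I.map_im (a := q) ht h₂ (by linarith : t + ε ≤ t' + ε),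
      ← I.map_im (a := p) ht (h₁.trans h₂) (by linarith : t + ε ≤ t' + ε)]
    have := finrank_map_add_le (N.map (t + ε) (t' + ε) ht (by linarith)) (I.im_mono h₁ h₂)
    omega
  refine ⟨fun p q t h h' => I.rank_mono hN h h', fun q t t' h h' => ?_, box⟩
  have h1 := box (min q M.res - 1) q t t' (by linarith [min_le_left q M.res]) h h'
  have h2 : min q M.res - 1 < M.res := by linarith [min_le_right q M.res]
  rw [I.rank_of_lt t h2, I.rank_of_lt t' h2] at h1
  omega

/-- Apply `φ` to the pair `M.im a' b ≤ M.im a b`. The next inequality applies `ψ` to the images of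
these two spaces; together they compare birth counts of `M` and of the image. -/
theorem rank_add_le (hM : M.IsPointwiseFinite) {a' a b : ℝ} (h : a' ≤ a) (h' : a ≤ b) :
    I.rank a b + M.rank a' b ≤ I.rank a' b + M.rank a b := by
  rcases lt_or_ge b M.res with hb | hb
  · simp only [I.rank_of_lt b (h'.trans_lt hb), module_rank_of_lt M b ((h.trans h').trans_lt hb),
      Nat.zero_add, Nat.zero_le]
  have := hM b hb
  rw [M.rank_eq, M.rank_eq]
  unfold rank
  rw [← I.map_φ_im hb h', ← I.map_φ_im hb (h.trans h')]
  exact finrank_map_add_le _ (M.im_mono h h')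

theorem add_rank_le (hN : N.IsPointwiseFinite) {a' a b : ℝ} (h : a' ≤ a) (h' : a ≤ b) :
    M.rank a (b + 2 * ε) + I.rank a' b ≤ M.rank a' (b + 2 * ε) + I.rank a b := by
  rcases lt_or_ge b M.res with hb | hb
  · simp only [I.rank_of_lt b ((h.trans h').trans_lt hb), module_rank_of_lt M _ (h'.trans_lt hb),
      Nat.zero_add, Nat.zero_le]
  have := finiteDimensional_right I hN hb
  rw [M.rank_eq, M.rank_eq]
  unfold rank
  rw [← I.map_ψ_im hb h', ← I.map_ψ_im hb (h.trans h')]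
  exact finrank_map_add_le _ (I.im_mono h h')

theorem rank_le (hN : N.IsPointwiseFinite) {a b : ℝ} (h : a ≤ b) :
    I.rank a b ≤ N.rank (a + ε) (b + ε) := by
  rcases lt_or_ge a M.res with ha | ha
  · rw [I.rank_of_lt b ha]
    exact Nat.zero_le _
  have := finiteDimensional_right I hN (ha.trans h)
  rw [N.rank_eq]
  exact Submodule.finrank_mono (I.im_le h)

theorem le_rank (hN : N.IsPointwiseFinite) {a b : ℝ} (h : a ≤ b) :
    N.rank (a - ε) (b + ε) ≤ I.rank a b := by
  have := I.nonneg
  rcases lt_or_ge a M.res with ha | ha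
  · rw [module_rank_of_lt N _ (by linarith [I.res_eq])]
    exact Nat.zero_le _
  have := finiteDimensional_right I hN (ha.trans h)
  rw [N.rank_eq]
  exact Submodule.finrank_mono (I.le_im h)

/-- Apply the structure map of `N` to the pair `I.im a b ≤ N.im (a + ε) (b + ε)`: what dies between
`b` and `b'` in the image also dies in `N`. The companion uses the pair `N.im (a - ε) (b + ε) ≤ I.im
a b`. -/
theorem rank_death_le (hN : N.IsPointwiseFinite) {a b b' : ℝ} (h : a ≤ b) (h' : b ≤ b') :
    I.rank a b + N.rank (a + ε) (b' + ε) ≤ I.rank a b' + N.rank (a + ε) (b + ε) := by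
  rcases lt_or_ge (b + ε) N.res with hb | hb
  · rw [I.rank_of_lt b (by linarith [I.nonneg, I.res_eq]), module_rank_of_lt N _ (by linarith)]
    exact Nat.zero_le _
  have := hN _ hb
  have hbb : b + ε ≤ b' + ε := by linarith
  rw [N.rank_eq, N.rank_eq, ← N.map_im (a := a + ε) hb (by linarith) hbb]
  unfold rank
  rw [← I.map_im (a := a) hb h hbb]
  have := finrank_map_add_le (N.map (b + ε) (b' + ε) hb hbb) (I.im_le h)
  omega

theorem le_rank_death (hN : N.IsPointwiseFinite) {a b b' : ℝ} (h : a ≤ b) (h' : b ≤ b') :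
    N.rank (a - ε) (b + ε) + I.rank a b' ≤ N.rank (a - ε) (b' + ε) + I.rank a b := by
  have := I.nonneg
  rcases lt_or_ge (b + ε) N.res with hb | hb
  · rw [I.rank_of_lt b' (by linarith [I.nonneg, I.res_eq]), module_rank_of_lt N _ (by linarith)]
    exact Nat.zero_le _
  have := hN _ hb
  have hbb : b + ε ≤ b' + ε := by linarith
  rw [N.rank_eq, N.rank_eq, ← N.map_im (a := a - ε) hb (by linarith) hbb]
  unfold rank
  rw [← I.map_im (a := a) hb h hbb]
  have := finrank_map_add_le (N.map (b + ε) (b' + ε) hb hbb) (I.le_im h)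
  omega

end PersistenceModule.Interleaving

/-! ### From interleavings to the bottleneck distance -/

theorem hasBoundedSupport_truncRank {r : ℝ → ℝ → ℕ} (L T : ℝ) (h : ∀ a t, a < L → r a t = 0) :
    HasBoundedSupport (truncRank r T) := by
  refine ⟨L, T, fun a t hat => ?_⟩
  rcases hat with hat | hat
  · unfold truncRank
    rw [h a t hat]
    simp
  · exact truncRank_of_le hat

/-- Matching of the points of interleaved persistence modules, with grid resolution `h`. -/
theorem PersistenceModule.Interleaving.exists_matching {M : PersistenceModule.{v₁} 𝕜}
    {N : PersistenceModule.{v₂} 𝕜} {ε h : ℝ} {m : ℕ} (I : M.Interleaving ε N)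
    (hM : M.IsPointwiseFinite) (hN : N.IsPointwiseFinite) {T T' : ℝ}
    (cM : EventuallyConstant M.rank T) (cN : EventuallyConstant N.rank T) (hT : T < T')
    (hh : 0 < h) (hε : ε = m * h) :
    ∃ e : (rankDiagram M.rank).Points ≃. (rankDiagram N.rank).Points,
      (∀ x y, y ∈ e x → |x.1.1.1 - y.1.1.1| ≤ ε + h ∧
        |truncDeath T' x.1.1.2 - truncDeath T' y.1.1.2| ≤ ε + h) ∧
      (∀ x, e x = none → truncDeath T' x.1.1.2 - x.1.1.1 ≤ 2 * (ε + h)) ∧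
      ∀ y, e.symm y = none → truncDeath T' y.1.1.2 - y.1.1.1 ≤ 2 * (ε + h) := by
  have rM := M.rankLike hM
  have rN := N.rankLike hN
  have rQ := I.rankLike hN
  have hε0 := I.nonneg
  have mQ := (rQ.truncate (T' - ε)).mono
  have mM := (rM.truncate T').mono
  -- The image at parameter `b` lives in `N.space (b + ε)`, so truncating `N` at `T'` means
  -- truncating the image at `T' - ε`.
  refine exists_matching_of_rank (rQ := truncRank I.rank (T' - ε)) (rM.represents_truncRank cM hT)
    (rN.represents_truncRank cN hT) (rM.truncate T') (rN.truncate T') (rQ.truncate _)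
    (hasBoundedSupport_truncRank M.res _ fun a t h => module_rank_of_lt M t h)
    (hasBoundedSupport_truncRank N.res _ fun a t h => module_rank_of_lt N t h)
    (hasBoundedSupport_truncRank M.res _ fun a t h => I.rank_of_lt t h) hh hε ?_ ?_ ?_ ?_
  · intro a' a b h₁ h₂
    have := mM a' a b h₁ h₂
    rcases lt_or_ge b (T' - ε) with hb | hb
    · rw [truncRank_of_lt hb, truncRank_of_lt hb, truncRank_of_lt (by linarith),
        truncRank_of_lt (by linarith)]
      exact I.rank_add_le hM h₁ h₂
    · rw [truncRank_of_le hb, truncRank_of_le hb]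
      omega
  · intro a' a b h₁ h₂
    have := mQ a' a b h₁ h₂
    rcases lt_or_ge (b + 2 * ε) T' with hb | hb
    · rw [truncRank_of_lt hb, truncRank_of_lt hb, truncRank_of_lt (by linarith),
        truncRank_of_lt (by linarith)]
      exact I.add_rank_le hN h₁ h₂
    · rw [truncRank_of_le hb, truncRank_of_le hb]
      omega
  · intro a b b' h₁ h₂
    rcases lt_or_ge (b' + ε) T' with hb | hb
    · rw [truncRank_of_lt hb, truncRank_of_lt (by linarith), truncRank_of_lt (by linarith),
        truncRank_of_lt (by linarith)]
      exact I.rank_death_le hN h₁ h₂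
    -- Both terms at `b'` are truncated away; what is left is the inclusion of the image in `N.im (a
    -- + ε) (b + ε)`.
    · rw [truncRank_of_le hb, truncRank_of_le (by linarith : T' - ε ≤ b')]
      rcases lt_or_ge (b + ε) T' with hb2 | hb2
      · rw [truncRank_of_lt hb2, truncRank_of_lt (by linarith)]
        have := I.rank_le hN h₁
        omega
      · rw [truncRank_of_le hb2, truncRank_of_le (by linarith)]
  · intro a b b' h₁ h₂
    rcases lt_or_ge (b' + ε) T' with hb | hb
    · rw [truncRank_of_lt hb, truncRank_of_lt (by linarith), truncRank_of_lt (by linarith),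
        truncRank_of_lt (by linarith)]
      exact I.le_rank_death hN h₁ h₂
    · rw [truncRank_of_le hb, truncRank_of_le (by linarith : T' - ε ≤ b')]
      rcases lt_or_ge (b + ε) T' with hb2 | hb2
      · rw [truncRank_of_lt hb2, truncRank_of_lt (by linarith)]
        have := I.le_rank hN h₁
        omega
      · rw [truncRank_of_le hb2, truncRank_of_le (by linarith)]

/-- All births and finite deaths are at most `T`, and `T'` is more than `2 * κ` beyond. So a point
of infinite death can be neither matched to one of finite death nor left unmatched, and the cost
with true deaths equals the one with truncated deaths. -/
theorem matchingCost_le {r r' : ℝ → ℝ → ℕ} {T T' κ : ℝ} (c : EventuallyConstant r T)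
    (c' : EventuallyConstant r' T) (hT : T + 2 * κ < T') (hκ : 0 ≤ κ)
    (e : (rankDiagram r).Points ≃. (rankDiagram r').Points)
    (h₁ : ∀ x y, y ∈ e x → |x.1.1.1 - y.1.1.1| ≤ κ ∧
      |truncDeath T' x.1.1.2 - truncDeath T' y.1.1.2| ≤ κ)
    (h₂ : ∀ x, e x = none → truncDeath T' x.1.1.2 - x.1.1.1 ≤ 2 * κ)
    (h₃ : ∀ y, e.symm y = none → truncDeath T' y.1.1.2 - y.1.1.1 ≤ 2 * κ) :
    matchingCost e ≤ ENNReal.ofReal κ := by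
  have diag : ∀ {r : ℝ → ℝ → ℕ}, EventuallyConstant r T → ∀ x : (rankDiagram r).Points,
      truncDeath T' x.1.1.2 - x.1.1.1 ≤ 2 * κ → diagonalDist x.1.1 ≤ ENNReal.ofReal κ := by
    rintro r c ⟨⟨⟨b, _ | d⟩, hb⟩, k⟩ hx
    · have := c.birth_le k
      change T' - b ≤ 2 * κ at hx
      linarith
    · change d - b ≤ 2 * κ at hx
      exact ENNReal.ofReal_le_ofReal (by linarith)
  refine max_le ?_ (max_le ?_ ?_)
  · refine iSup_le fun x => iSup_le fun y => iSup_le fun hxy => ?_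
    obtain ⟨hb, hd⟩ := h₁ x y hxy
    refine max_le ?_ ?_
    · rw [edist_dist, Real.dist_eq]
      exact ENNReal.ofReal_le_ofReal hb
    · obtain ⟨⟨⟨b, _ | d⟩, hb⟩, k⟩ := x
      · obtain ⟨⟨⟨b', _ | d'⟩, hb'⟩, k'⟩ := y
        · exact zero_le
        · have := c'.death_le k'
          change |T' - d'| ≤ κ at hd
          rw [abs_le] at hd
          linarith
      · obtain ⟨⟨⟨b', _ | d'⟩, hb'⟩, k'⟩ := y
        · have := c.death_le k
          change |d - T'| ≤ κ at hd
          rw [abs_le] at hd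
          linarith
        · change edist d d' ≤ _
          rw [edist_dist, Real.dist_eq]
          exact ENNReal.ofReal_le_ofReal hd
  · exact iSup_le fun x => iSup_le fun hx => diag c x (h₂ x hx)
  · exact iSup_le fun y => iSup_le fun hy => diag c' y (h₃ y hy)

/-- Algebraic stability: the bottleneck distance of the diagrams of `ε`-interleaved pointwise
finite dimensional persistence modules is at most `ε`. -/
theorem PersistenceModule.Interleaving.bottleneckDist_le {M : PersistenceModule.{v₁} 𝕜}
    {N : PersistenceModule.{v₂} 𝕜} {ε : ℝ} (I : M.Interleaving ε N)
    (hM : M.IsPointwiseFinite) (hN : N.IsPointwiseFinite) {T : ℝ}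
    (cM : EventuallyConstant M.rank T) (cN : EventuallyConstant N.rank T) (hε : 0 < ε) :
    bottleneckDist M.diagram N.diagram ≤ ENNReal.ofReal ε := by
  refine ENNReal.le_of_forall_pos_le_add fun κ hκ _ => ?_
  have hκ' : (0 : ℝ) < κ := hκ
  -- The mesh must divide `ε` and be at most the allowed error `κ`: take `ε / n`.
  obtain ⟨n, hn⟩ := exists_nat_gt (ε / κ)
  have hn0 : (0 : ℝ) < n := lt_trans (by positivity) hn
  have hh : 0 < ε / n := by positivity
  have hle : ε / n ≤ κ := by
    rw [div_le_iff₀ hn0]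
    rw [div_lt_iff₀ hκ'] at hn
    linarith
  obtain ⟨e, h₁, h₂, h₃⟩ := I.exists_matching hM hN (T' := T + 2 * (ε + ε / n) + 1) cM cN
    (by linarith) hh (by field_simp : ε = n * (ε / n))
  refine (iInf_le _ e).trans ((matchingCost_le cM cN (lt_add_one _) (by linarith) e h₁ h₂ h₃).trans ?_)
  rw [ENNReal.ofReal_add hε.le hh.le]
  refine add_le_add_right ?_ _
  rw [← ENNReal.ofReal_coe_nnreal]
  exact ENNReal.ofReal_le_ofReal hle

/-- The rank function of a module whose maps are eventually bijective is eventually constant. -/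
theorem PersistenceModule.eventuallyConstant_rank (M : PersistenceModule.{v₁} 𝕜) {T : ℝ}
    (hT : M.res ≤ T)
    (h : ∀ t t' (ht : T ≤ t) (ht' : t ≤ t'), Function.Bijective (M.map t t' (hT.trans ht) ht')) :
    EventuallyConstant M.rank T where
  death a t t' ht ht' hat := by
    rw [M.rank_eq, M.rank_eq, ← M.map_im (hT.trans ht) hat ht']
    exact (LinearEquiv.finrank_eq (Submodule.equivMapOfInjective _ (h t t' ht ht').1 _))
  birth a a' t ha haa hat := by
    rw [M.rank_eq, M.rank_eq, M.im_eq_range (hT.trans ha) (haa.trans hat),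
      M.im_eq_range (hT.trans (ha.trans haa)) hat,
      LinearMap.range_eq_top.2 (h a t ha (haa.trans hat)).2,
      LinearMap.range_eq_top.2 (h a' t (ha.trans haa) hat).2]

end Algebraic

/-! ### Nerves of covers -/

section Nerve

variable (𝕜 : Type w) [Field 𝕜] {X : Type u}

/-- Any two maps of covers induce the same map on the homology of the nerves. -/
theorem homologyMap_nerveMap_eq {A : Type v} {B : Type v'} {U : A → Set X} {U' : B → Set X}
    (ξ ξ' : A → B) (hξ : ∀ α, U α ⊆ U' (ξ α)) (hξ' : ∀ α, U α ⊆ U' (ξ' α)) (k : ℕ) :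
    homologyMap 𝕜 (nerveMap ξ hξ) k = homologyMap 𝕜 (nerveMap ξ' hξ') k := by
  classical
  refine Contiguous.homologyMap_eq 𝕜 ?_ k
  rintro σ ⟨⟨α, hα⟩, x, hx⟩
  -- A common point of the sets indexed by `σ` lies in all target sets under both maps, so the two
  -- images of `σ` together span a simplex.
  refine ⟨σ.image ξ ∪ σ.image ξ', ⟨⟨ξ α, ?_⟩, x, ?_⟩, fun β hβ => ⟨?_, ?_⟩⟩
  · exact Finset.mem_union_left _ (Finset.mem_image_of_mem _ hα)
  · simp only [Set.mem_iInter, Finset.mem_union, Finset.mem_image] at hx ⊢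
    rintro _ (⟨β, hβ, rfl⟩ | ⟨β, hβ, rfl⟩)
    · exact hξ β (hx β hβ)
    · exact hξ' β (hx β hβ)
  · exact Finset.mem_union_left _ (Finset.mem_image_of_mem _ hβ)
  · exact Finset.mem_union_right _ (Finset.mem_image_of_mem _ hβ)

theorem homologyMap_nerveMap_comp {A : Type v} {B : Type v'} {C : Type t} {U : A → Set X}
    {U' : B → Set X} {U'' : C → Set X} (ξ : A → B) (hξ : ∀ α, U α ⊆ U' (ξ α)) (ζ : B → C)
    (hζ : ∀ β, U' β ⊆ U'' (ζ β)) (ω : A → C) (hω : ∀ α, U α ⊆ U'' (ω α)) (k : ℕ)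
    (x : Homology 𝕜 (nerve U) k) :
    homologyMap 𝕜 (nerveMap ζ hζ) k (homologyMap 𝕜 (nerveMap ξ hξ) k x) =
      homologyMap 𝕜 (nerveMap ω hω) k x := by
  rw [← homologyMap_comp]
  exact LinearMap.congr_fun (homologyMap_nerveMap_eq 𝕜 (ζ ∘ ξ) ω
    (fun α => (hξ α).trans (hζ _)) hω k) x

instance {V : Type u} [Finite V] (K : PreAbstractSimplicialComplex V) (n : ℕ) :
    Finite (OrderedSimplex K n) :=
  Subtype.finite

instance {V : Type u} [Finite V] (K : PreAbstractSimplicialComplex V) (n : ℕ) :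
    FiniteDimensional 𝕜 (Chains 𝕜 K n) :=
  inferInstanceAs (FiniteDimensional 𝕜 (OrderedSimplex K n →₀ 𝕜))

theorem finiteDimensional_homology {V : Type u} [Finite V] (K : PreAbstractSimplicialComplex V)
    (k : ℕ) : FiniteDimensional 𝕜 (Homology 𝕜 K k) :=
  inferInstance

theorem CoverTower.IsFinite.isPointwiseFinite {W : CoverTower.{u, v} X} (h : W.IsFinite) (k : ℕ) :
    (W.nerveTower.homology 𝕜 k).IsPointwiseFinite := by
  intro ε hε
  have : Finite (W.Idx ε) := h ε hε
  exact finiteDimensional_homology 𝕜 (nerve (W.elem ε)) k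

/-- Maps of covers in both directions interleave the homology of the nerves. -/
def CoverTower.interleaving (W : CoverTower.{u, v} X) (W' : CoverTower.{u, v'} X) {ε : ℝ}
    (hε : 0 ≤ ε) (hres : W'.res = W.res)
    (h : ∀ a b, W.res ≤ a → a + ε ≤ b →
      ∃ ξ : W.Idx a → W'.Idx b, ∀ α, W.elem a α ⊆ W'.elem b (ξ α))
    (h' : ∀ a b, W.res ≤ a → a + ε ≤ b →
      ∃ ξ : W'.Idx a → W.Idx b, ∀ α, W'.elem a α ⊆ W.elem b (ξ α)) (k : ℕ) :
    (W.nerveTower.homology 𝕜 k).Interleaving ε (W'.nerveTower.homology 𝕜 k) where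
  nonneg := hε
  res_eq := hres
  -- The cover maps are chosen separately for each pair of parameters. They need not be compatible,
  -- but their effect on homology does not depend on the choice.
  φ a b ha hab := homologyMap 𝕜 (nerveMap (h a b ha hab).choose (h a b ha hab).choose_spec) k
  ψ a b ha hab := homologyMap 𝕜 (nerveMap (h' a b ha hab).choose (h' a b ha hab).choose_spec) k
  map_φ _ b b' _ _ hb h x :=
    homologyMap_nerveMap_comp 𝕜 _ _ _ (W'.elem_subset b b' hb h) _ _ k x
  φ_map a a' _ ha h _ _ _ x :=
    homologyMap_nerveMap_comp 𝕜 _ (W.elem_subset a a' ha h) _ _ _ _ k x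
  ψ_φ a _ c ha _ _ _ h x :=
    homologyMap_nerveMap_comp 𝕜 _ _ _ _ _ (W.elem_subset a c ha h) k x
  φ_ψ a _ c _ _ _ _ ha h x :=
    homologyMap_nerveMap_comp 𝕜 _ _ _ _ _ (W'.elem_subset a c ha h) k x

/-- A map of covers in the opposite direction makes the structure map on homology bijective. -/
theorem CoverTower.bijective_map (W : CoverTower.{u, v} X) {a b : ℝ} (ha : W.res ≤ a)
    (hab : a ≤ b) (h : ∃ ξ : W.Idx b → W.Idx a, ∀ α, W.elem b α ⊆ W.elem a (ξ α)) (k : ℕ) :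
    Function.Bijective ((W.nerveTower.homology 𝕜 k).map a b ha hab) := by
  obtain ⟨ξ, hξ⟩ := h
  refine Function.bijective_iff_has_inverse.2 ⟨homologyMap 𝕜 (nerveMap ξ hξ) k, fun x => ?_,
    fun x => ?_⟩
  · exact (homologyMap_nerveMap_comp 𝕜 _ (W.elem_subset a b ha hab) _ hξ id
      (fun _ => Set.Subset.rfl) k x).trans (homologyMap_id 𝕜 _ k x)
  · exact (homologyMap_nerveMap_comp 𝕜 _ hξ _ (W.elem_subset a b ha hab) id (fun _ => Set.Subset.rfl) k x).trans
      (homologyMap_id 𝕜 _ k x)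

end Nerve

/-! ### Pullbacks of good towers -/

theorem CoverTower.exists_pullback_map {X : Type u} {Z : Type w} [TopologicalSpace X]
    {f g : X → Z} {W : CoverTower.{w, v} Z} {W' : CoverTower.{w, v'} Z} {a b : ℝ}
    (h : ∀ α : W.Idx a, ∃ β : W'.Idx b, f ⁻¹' W.elem a α ⊆ g ⁻¹' W'.elem b β) :
    ∃ ξ : (W.pullback f).Idx a → (W'.pullback g).Idx b,
      ∀ p, (W.pullback f).elem a p ⊆ (W'.pullback g).elem b (ξ p) := by
  choose β hβ using h
  refine ⟨fun p => ⟨β p.1, pathComponentsMap (hβ p.1) p.2⟩, ?_⟩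
  rintro p x ⟨hx, hp⟩
  exact ⟨hβ p.1 hx, congrArg (pathComponentsMap (hβ p.1)) hp⟩

section Good

variable {Z : Type u} [MetricSpace Z] [CompactSpace Z] {c s : ℝ}

theorem IsGood.res_le {W : CoverTower.{u, v} Z} (hW : IsGood c s W) {ε : ℝ} (h : s ≤ ε) :
    W.res ≤ ε :=
  hW.res_eq.trans_le h

/-- The elements of the cover at `ε` contain all sets of small diameter. -/
theorem IsGood.exists_superset_of_le {W : CoverTower.{u, v} Z} (hW : IsGood c s W) {O : Set Z}
    {ε : ℝ} (hO : s ≤ Metric.diam O) (hε : c * Metric.diam O ≤ ε) : ∃ α, O ⊆ W.elem ε α := by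
  obtain ⟨α, hα⟩ := hW.exists_superset O hO
  have hs : s ≤ c * Metric.diam O := by nlinarith [hW.one_le, hW.pos]
  exact ⟨W.map _ _ (hW.res_le hs) hε α, hα.trans (W.elem_subset _ _ _ _ α)⟩

/-- Goodness says nothing about sets of diameter below `s`, so the thickening must be shown to be
large. If a closed `ρ`-ball about a point of `A` is all of `Z`, this is `s ≤ diam Z`. Otherwise, by
connectedness, some point has distance exactly `ρ` from that point, and both lie in the thickening.
-/
theorem le_diam_cthickening [PathConnectedSpace Z] {A : Set Z} (hA : A.Nonempty) {ρ : ℝ}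
    (hs : s ≤ ρ) (hρ : 0 ≤ ρ) (hZ : s ≤ Metric.diam (Set.univ : Set Z)) :
    s ≤ Metric.diam (Metric.cthickening ρ A) := by
  obtain ⟨x, hx⟩ := hA
  have hball : Metric.closedBall x ρ ⊆ Metric.cthickening ρ A :=
    Metric.closedBall_subset_cthickening hx ρ
  have hbdd : ∀ B : Set Z, Bornology.IsBounded B := fun B => Metric.isBounded_of_compactSpace
  by_cases hall : ∀ y, dist x y ≤ ρ
  · have huniv : Metric.cthickening ρ A = Set.univ :=
      Set.eq_univ_of_forall fun y => hball (by rw [Metric.mem_closedBall, dist_comm]; exact hall y)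
    rwa [huniv]
  · push Not at hall
    obtain ⟨y, hy⟩ := hall
    obtain ⟨z, hz⟩ := mem_range_of_exists_le_of_exists_ge (f := fun z => dist x z) (c := ρ)
      (by fun_prop) ⟨x, by simpa using hρ⟩ ⟨y, hy.le⟩
    refine hs.trans (hz.symm.trans_le (Metric.dist_le_diam_of_mem (hbdd _) (hball ?_) (hball ?_)))
    · exact Metric.mem_closedBall_self hρ
    · rw [Metric.mem_closedBall, dist_comm]
      exact hz.le

/-- Preimages of cover elements under `f` are contained in preimages under a map close to `f`. -/
theorem IsGood.exists_preimage_subset [PathConnectedSpace Z] {X : Type w}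
    {W : CoverTower.{u, v} Z} {W' : CoverTower.{u, v'} Z} [TopologicalSpace X]
    (hW : IsGood c s W) (hW' : IsGood c s W') (hWo : W.IsOpenPathConnected) {f g : X → Z} {δ : ℝ}
    (hfg : ∀ x, dist (f x) (g x) ≤ δ) {ε ε' : ℝ} (hε : s ≤ ε)
    (hε' : c * (ε + 2 * max s δ) ≤ ε') (α : W.Idx ε) :
    ∃ β : W'.Idx ε', f ⁻¹' W.elem ε α ⊆ g ⁻¹' W'.elem ε' β := by
  -- The thickening radius is `max s δ`: at least `s` to reach the diameter that goodness requires,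
  -- at least `δ` to contain `g x` whenever `f x` is in the element.
  have hρ : 0 ≤ max s δ := hW.pos.le.trans (le_max_left _ _)
  have hc : 0 ≤ c := zero_le_one.trans hW.one_le
  have hne := (hWo ε (hW.res_le hε) α).2.nonempty
  have h1 := le_diam_cthickening hne (le_max_left s δ) hρ hW.le_diam
  have h2 : Metric.diam (Metric.cthickening (max s δ) (W.elem ε α)) ≤ ε + 2 * max s δ :=
    (Metric.diam_cthickening_le _ hρ).trans (by linarith [hW.diam_le ε hε α])
  obtain ⟨β, hβ⟩ := hW'.exists_superset_of_le h1 ((mul_le_mul_of_nonneg_left h2 hc).trans hε')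
  refine ⟨β, fun x hx => hβ (Metric.closedBall_subset_cthickening (show f x ∈ W.elem ε α from hx) _ ?_)⟩
  rw [Metric.mem_closedBall, dist_comm]
  exact (hfg x).trans (le_max_right _ _)

/-- From `c * diam Z` on, every preimage is contained in a single cover element. -/
theorem IsGood.exists_preimage_subset_of_diam_le {X : Type w} {W : CoverTower.{u, v} Z}
    (hW : IsGood c s W) (f : X → Z) {ε ε' : ℝ}
    (hε' : c * Metric.diam (Set.univ : Set Z) ≤ ε') (α : W.Idx ε) :
    ∃ β : W.Idx ε', f ⁻¹' W.elem ε α ⊆ f ⁻¹' W.elem ε' β := by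
  obtain ⟨β, hβ⟩ := hW.exists_superset_of_le hW.le_diam hε'
  exact ⟨β, fun x _ => hβ (Set.mem_univ _)⟩

theorem IsGood.isFinite_pullback {X : Type w} [TopologicalSpace X] {W : CoverTower.{u, v} Z}
    (hW : IsGood c s W) (hWo : W.IsOpenPathConnected) {f : X → Z} (hf : WellBehaved f) :
    (W.reindexLog.pullback f).IsFinite := by
  intro a ha
  have hle : W.res ≤ Real.exp a := by
    rw [hW.res_eq]
    have ha' : Real.log s ≤ a := hW.res_eq ▸ ha
    exact (Real.log_le_iff_le_exp hW.pos).1 ha'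
  have : Finite (W.Idx (Real.exp a)) := hW.finite _ hle
  have : ∀ α : W.Idx (Real.exp a), Finite (ZerothHomotopy (f ⁻¹' W.elem (Real.exp a) α)) :=
    fun α => hf _ (hWo _ hle α).1 (hWo _ hle α).2
  exact inferInstanceAs (Finite (Σ α : W.Idx (Real.exp a),
    ZerothHomotopy (f ⁻¹' W.elem (Real.exp a) α)))

/-- Beyond `c * diam Z` some cover element contains all of `Z`, so covers at later scales also map
back to earlier ones, and such backward maps invert the structure maps on homology. -/
theorem IsGood.eventuallyConstant (𝕜 : Type*) [Field 𝕜] {X : Type w} [TopologicalSpace X]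
    {W : CoverTower.{u, v} Z} (hW : IsGood c s W) (f : X → Z) (k : ℕ) :
    EventuallyConstant ((MM W.reindexLog f).homology 𝕜 k).rank
      (Real.log (c * Metric.diam (Set.univ : Set Z))) := by
  have hs : s ≤ c * Metric.diam (Set.univ : Set Z) := by
    nlinarith [hW.one_le, hW.pos, hW.le_diam]
  have hres : Real.log W.res ≤ Real.log (c * Metric.diam (Set.univ : Set Z)) := by
    rw [hW.res_eq]
    exact Real.log_le_log hW.pos hs
  refine PersistenceModule.eventuallyConstant_rank _ hres fun t t' ht ht' => ?_
  refine CoverTower.bijective_map 𝕜 (W.reindexLog.pullback f) (hres.trans ht) ht' ?_ k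
  refine CoverTower.exists_pullback_map fun α => ?_
  exact hW.exists_preimage_subset_of_diam_le f
    ((Real.log_le_iff_le_exp (hW.pos.trans_le hs)).1 ht) α

end Good

/-- The additive `2cρ` has to be absorbed in a multiple of `E = exp a`. If `E ≥ 1`, then `2cρ ≤ 2cρ
E`. If `E < 1`, the extra factor, at least `1 / s`, makes up for it: its product with `E ≥ s` is at
least `1`, and `c E ≤ c`. -/
theorem mul_exp_add_le_exp {c s η ρ a b : ℝ} (hc : 1 ≤ c) (hs : 0 < s) (hη : 0 ≤ η) (hρ : 0 ≤ ρ)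
    (ha : s ≤ Real.exp a)
    (hab : a + (Real.log (2 * c * ρ + c + η) + max 0 (Real.log (1 / s))) ≤ b) :
    c * (Real.exp a + 2 * ρ) ≤ Real.exp b := by
  have hcρ : 0 ≤ 2 * c * ρ := by positivity
  have hK : 0 < 2 * c * ρ + c + η := by linarith
  refine le_trans ?_ (Real.exp_le_exp.2 hab)
  rw [Real.exp_add, Real.exp_add, Real.exp_log hK]
  have hE := Real.exp_pos a
  rcases le_or_gt 1 (Real.exp a) with h1 | h1
  · have h2 : 1 ≤ Real.exp (max 0 (Real.log (1 / s))) := Real.one_le_exp (le_max_left _ _)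
    have h3 : 2 * c * ρ + c + η ≤ (2 * c * ρ + c + η) * Real.exp (max 0 (Real.log (1 / s))) :=
      le_mul_of_one_le_right hK.le h2
    nlinarith
  · have h2 : 1 / s ≤ Real.exp (max 0 (Real.log (1 / s))) := by
      rw [← Real.log_le_iff_le_exp (by positivity)]
      exact le_max_right _ _
    have h3 : 1 ≤ Real.exp a * (1 / s) := by
      rw [mul_one_div, le_div_iff₀ hs]
      linarith
    have h4 : 1 ≤ Real.exp a * Real.exp (max 0 (Real.log (1 / s))) :=
      h3.trans (mul_le_mul_of_nonneg_left h2 hE.le)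
    have h5 : (2 * c * ρ + c + η) * 1 ≤
        (2 * c * ρ + c + η) * (Real.exp a * Real.exp (max 0 (Real.log (1 / s)))) :=
      mul_le_mul_of_nonneg_left h4 hK.le
    nlinarith

end MultiscaleMapper

end

theorem mainTheorem1 {𝕜 : Type*} [Field 𝕜] {X Z : Type*} [TopologicalSpace X]
    [MetricSpace Z] [CompactSpace Z] [PathConnectedSpace Z]
    (c s η δ : ℝ)
    (U V : MultiscaleMapper.CoverTower Z)
    (hUo : U.IsOpenPathConnected) (hVo : V.IsOpenPathConnected)
    (hU : MultiscaleMapper.IsGood c s U) (hV : MultiscaleMapper.IsGood c s V)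
    (hUV : MultiscaleMapper.Interleaved η U V)
    (f g : C(X, Z))
    (hf : MultiscaleMapper.WellBehaved f) (hg : MultiscaleMapper.WellBehaved g)
    (hfg : ∀ x, dist (f x) (g x) ≤ δ) (k : ℕ) :
    ((MultiscaleMapper.MM U.reindexLog f).homology 𝕜 k).IsPointwiseFinite ∧
    ((MultiscaleMapper.MM V.reindexLog g).homology 𝕜 k).IsPointwiseFinite ∧
    MultiscaleMapper.bottleneckDist
        ((MultiscaleMapper.MM U.reindexLog f).diagram 𝕜 k)
        ((MultiscaleMapper.MM V.reindexLog g).diagram 𝕜 k) ≤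
      ENNReal.ofReal (Real.log (2 * c * max s δ + c + η) + max 0 (Real.log (1 / s))) := by
  have hM := (hU.isFinite_pullback hUo hf).isPointwiseFinite 𝕜 k
  have hN := (hV.isFinite_pullback hVo hg).isPointwiseFinite 𝕜 k
  refine ⟨hM, hN, ?_⟩
  have hc := hU.one_le
  have hs := hU.pos
  have hη : 0 ≤ η := hUV.1
  have hρ : 0 < max s δ := hs.trans_le (le_max_left _ _)
  -- The stability bound is applied with a positive shift. The logarithm is positive because `c ≥ 1`
  -- and `c * max s δ > 0` push its argument above `1`.
  have hω : 0 < Real.log (2 * c * max s δ + c + η) + max 0 (Real.log (1 / s)) := by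
    have h0 : 0 < c * max s δ := mul_pos (by linarith) hρ
    have h1 : 0 < Real.log (2 * c * max s δ + c + η) := Real.log_pos (by linarith)
    linarith [le_max_left 0 (Real.log (1 / s))]
  have hgf : ∀ x, dist (g x) (f x) ≤ δ := fun x => by
    rw [dist_comm]
    exact hfg x
  have hresU : ∀ a, U.reindexLog.res ≤ a → s ≤ Real.exp a := fun a ha =>
    (Real.log_le_iff_le_exp hs).1 ((congrArg Real.log hU.res_eq).symm.trans_le ha)
  refine MultiscaleMapper.PersistenceModule.Interleaving.bottleneckDist_le
    (MultiscaleMapper.CoverTower.interleaving 𝕜 (U.reindexLog.pullback f)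
      (V.reindexLog.pullback g) hω.le ?_ ?_ ?_ k) hM hN
    (hU.eventuallyConstant 𝕜 f k) (hV.eventuallyConstant 𝕜 g k) hω
  · exact congrArg Real.log (hV.res_eq.trans hU.res_eq.symm)
  · intro a b ha hab
    exact MultiscaleMapper.CoverTower.exists_pullback_map
      (hU.exists_preimage_subset hV hUo hfg (hresU a ha)
        (MultiscaleMapper.mul_exp_add_le_exp hc hs hη hρ.le (hresU a ha) hab))
  · intro a b ha hab
    exact MultiscaleMapper.CoverTower.exists_pullback_map
      (hV.exists_preimage_subset hU hVo hgf (hresU a ha)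
        (MultiscaleMapper.mul_exp_add_le_exp hc hs hη hρ.le (hresU a ha) hab))
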